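/- **Setting.** A transmitter with $L$ antennas serves $K$ users with $G$ receive antennas each. The channel matrices $H_k\in\mathbb C^{G\times L}$, $k\in[K]$, have i.i.d. $\mathcal{CN}(0,1)$ entries and are known to the transmitter; user $k$ receives $y_k=H_kx+z_k$. Let $t\ge 0$ and $t+1\le\Omega\le K$. Each of $N$ files $W_n$ is split into $\binom Kt$ packets $W_{n,P}$, $P\subseteq[K]$, $|P|=t$, and user $k$ caches all packets with $k\in P$. Each user $k$ then requests one file $W_{d_k}$. Put $$\beta_0=\frac{t+1}{\gcd(t+1,\Omega)},\qquad B_0=\frac{\Omega}{\gcd(t+1,\Omega)},\qquad S_0=\binom{\Omega}{t+1}\Big/B_0 .$$ For a set $\mathcal K$ of $\Omega$ users, a *base schedule* is a partition of $\{T\subseteq\mathcal K:|T|=t+1\}$ into $S_0$ columns such that the sets in each column cover $\mathcal K$ and each user $k\in\mathcal K$ lies in exactly $\beta_0$ sets of each column. **Theorem.** Let $\delta,\eta\ge1$ be integers such that $\delta S_0/\eta$ is an integer and $$\eta\le\min\left(\frac{L S_0}{1+(\Omega-t-1)S_0\beta_0},\ \frac{G}{\beta_0}\right).$$ Then every $\mathcal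 K$ with $|\mathcal K|=\Omega$ has a base schedule, and for any choice of base schedules the following is a linear multicast coded-caching scheme in which every target user decodes $\beta=\eta\beta_0$ streams in each transmission. Split every packet into $\delta\binom{K-t-1}{\Omega-t-1}$ subpackets. For each $\mathcal K$, concatenate $\delta$ copies of its base schedule to a table of $\delta S_0$ columns and cut the table into $\delta S_0/\eta$ blocks of $\eta$ consecutive columns; each block is one transmission. The entry $T$ of copy $i$ of the table of $\mathcal K$ stands for the codeword $\bigoplus_{k\in T}W^{q}_{d_k,T\setminus\{k\}}$, a bitwise XOR of $t+1$ subpackets, where the numbering $q=q(T,\mathcal K,i)$ is such that for each $T$ the map $(\mathcal K,i)\mapsto q$, for $\mathcal K\supseteq T$ and $i\in[\delta]$, is a bijection onto the set of subpacket indices; such numberings exist, and any of them may be used. Precisely: 1. In every transmission to $\mathcal K$ all codewords are indexed by sets $T\subseteq\mathcal K$ with $|T|=t+1$, and each $k\in\mathcal K$ belongs to exactly $\beta=\eta\beta_0$ of them. 2. Almost surely with respect to the channels, for every transmission there are transmit beamformers $w_j\in\mathbb C^L$, one for each codeword $j$ of the block, such that for every target user $k\in\mathcal K$ and every codeword $j$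 of the block whose index set contains $k$ there is a receive vector $u_{k,j}\in\mathbb C^G$ with $$u_{k,j}^{H}\Big(H_k\sum_i w_i s_i+z\Big)=s_j+u_{k,j}^{H}z$$ for all symbols $s_i$ (one for each codeword $i$ of the block) and all noise vectors $z$; that is, each target user decodes its $\beta$ streams free of interference with a linear receiver. 3. For all requests, each user $k$ obtains from each codeword whose index set contains $k$, together with its cache, the subpacket $W^{q}_{d_k,T\setminus\{k\}}$; over all transmissions these subpackets are pairwise distinct and none is cached by $k$, and altogether they and the cache determine the requested file $W_{d_k}$. -/

import Mathlib

open MeasureTheory ProbabilityTheory Matrix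

/-- `β₀ = (t+1) / gcd(t+1, Ω)` (the division is exact). -/
def beta0 (t Ω : ℕ) : ℕ := (t + 1) / Nat.gcd (t + 1) Ω

/-- `B₀ = Ω / gcd(t+1, Ω)` (the division is exact). -/
def B0 (t Ω : ℕ) : ℕ := Ω / Nat.gcd (t + 1) Ω

/-- `S₀ = binom(Ω, t+1) / B₀` (the division is exact). -/
def S0 (t Ω : ℕ) : ℕ := Nat.choose Ω (t + 1) / B0 t Ω

/-- Packet indices: the sets of `t` users out of `K`. -/
abbrev PacketIdx (K t : ℕ) : Type := {P : Finset (Fin K) // P.card = t}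

/-- Codeword indices: the sets of `t + 1` users out of `K`. -/
abbrev CodewordIdx (K t : ℕ) : Type := {T : Finset (Fin K) // T.card = t + 1}

/-- Target user sets: the sets of `Ω` users out of `K`. -/
abbrev TargetSet (K Ω : ℕ) : Type := {A : Finset (Fin K) // A.card = Ω}

/-- The packet index `T \ {k}` for a codeword index `T` and a user `k ∈ T`. -/
def CodewordIdx.packet {K t : ℕ} (T : CodewordIdx K t) (k : Fin K) (hk : k ∈ T.1) :
    PacketIdx K t :=
  ⟨T.1.erase k, by rw [Finset.card_erase_of_mem hk, T.2]; rfl⟩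

/-- A base schedule for the target set `A`: a partition of the codeword indices `T ⊆ A` into
`S₀` columns, each of which covers `A` and contains every user of `A` exactly `β₀` times. -/
structure BaseSchedule {K : ℕ} (t Ω : ℕ) (A : TargetSet K Ω) where
  column : Fin (S0 t Ω) → Finset (CodewordIdx K t)
  subset_target : ∀ s, ∀ T ∈ column s, T.1 ⊆ A.1
  partition : ∀ T : CodewordIdx K t, T.1 ⊆ A.1 → ∃! s, T ∈ column s
  covers : ∀ s, (column s).biUnion (fun T => T.1) = A.1
  regular : ∀ s, ∀ k ∈ A.1, ((column s).filter (fun T => k ∈ T.1)).card = beta0 t Ω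

/-- The number of subpackets into which each packet is split: `δ · binom(K-t-1, Ω-t-1)`. -/
def numSub (K t Ω δ : ℕ) : ℕ := δ * Nat.choose (K - t - 1) (Ω - t - 1)

/-- The free choices of the delivery scheme: a base schedule for every target set, and a numbering
of the subpackets. The copy number `d` of the codeword `T` sent to the target set `A` carries the
subpackets with the super-index `label T A d`; for a fixed `T` every super-index is used for
exactly one pair `(A, d)` with `T ⊆ A`, so that no subpacket is repeated. -/
structure DeliveryPlan (K t Ω δ : ℕ) where
  base : ∀ A : TargetSet K Ω, BaseSchedule t Ω A
  label : CodewordIdx K t → TargetSet K Ω → Fin δ → Fin (numSub K t Ω δ)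
  label_bijOn : ∀ T : CodewordIdx K t,
    Set.BijOn (fun x : TargetSet K Ω × Fin δ => label T x.1 x.2) {x | T.1 ⊆ x.1.1} Set.univ

/-- The codewords of one transmission. Concatenating `δ` copies of the base schedule gives a table
with `δ S₀` columns, in which column `s` of copy `d` has the (zero-based) number `S₀ d + s`; this
table is cut into `δ S₀ / η` blocks of `η` consecutive columns, and the result is the set of all
codewords `(d, T)` in block number `r`. -/
def DeliveryPlan.block {K t Ω δ : ℕ} (p : DeliveryPlan K t Ω δ) (η : ℕ) (A : TargetSet K Ω)
    (r : Fin (δ * S0 t Ω / η)) : Finset (Fin δ × CodewordIdx K t) :=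
  ((Finset.univ : Finset (Fin δ × Fin (S0 t Ω))).filter
      (fun c => (S0 t Ω * c.1.1 + c.2.1) / η = r.1)).biUnion
    (fun c => ((p.base A).column c.2).image (fun T => (c.1, T)))

/-- A subpacket consists of `b` bits; addition is the bitwise XOR. -/
abbrev Bits (b : ℕ) : Type := Fin b → ZMod 2

/-- A file: one `Q`-tuple of subpackets for every packet index. -/
abbrev FileData (K t Q b : ℕ) : Type := PacketIdx K t → Fin Q → Bits b

/-- What user `k` stores in the placement phase: of every file, the packets `P` with `k ∈ P`. -/
abbrev CacheData (K N t Q b : ℕ) (k : Fin K) : Type :=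
  Fin N → {P : PacketIdx K t // k ∈ P.1} → Fin Q → Bits b

/-- The cache contents of user `k` for the library `W` of `N` files. -/
def cacheOf {K N t Q b : ℕ} (W : Fin N → FileData K t Q b) (k : Fin K) :
    CacheData K N t Q b k :=
  fun n P q => W n P.1 q

/-- The XOR codeword for the users in `T` (copy `d`, target set `A`): the XOR over `k ∈ T` of the
subpackets with packet index `T \ {k}` of the files requested by the users `k`. -/
def DeliveryPlan.codeword {K t Ω δ N b : ℕ} (p : DeliveryPlan K t Ω δ)
    (W : Fin N → FileData K t (numSub K t Ω δ) b) (dem : Fin K → Fin N)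
    (A : TargetSet K Ω) (d : Fin δ) (T : CodewordIdx K t) : Bits b :=
  ∑ k : {k // k ∈ T.1}, W (dem k.1) (T.packet k.1 k.2) (p.label T A d)

/-- The streams for user `k`: all `(A, r, (d, T))` such that the codeword `(d, T)` is sent in the
block `r` for the target set `A`, and `k ∈ T`. -/
abbrev DeliveryPlan.Stream {K t Ω δ : ℕ} (p : DeliveryPlan K t Ω δ) (η : ℕ) (k : Fin K) : Type :=
  {y : TargetSet K Ω × Fin (δ * S0 t Ω / η) × (Fin δ × CodewordIdx K t) //
    y.2.2 ∈ p.block η y.1 y.2.1 ∧ k ∈ y.2.2.2.1}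

/-- The (packet index, super-index) of the subpacket that a stream carries for user `k`. -/
def DeliveryPlan.subpacketOf {K t Ω δ : ℕ} (p : DeliveryPlan K t Ω δ) {η : ℕ} {k : Fin K}
    (y : p.Stream η k) : PacketIdx K t × Fin (numSub K t Ω δ) :=
  (y.1.2.2.2.packet k y.2.2, p.label y.1.2.2.2 y.1.1 y.1.2.2.1)

/-- The XOR codeword sent on a stream of user `k`. -/
def DeliveryPlan.codewordOf {K t Ω δ N b : ℕ} (p : DeliveryPlan K t Ω δ) {η : ℕ} {k : Fin K}
    (W : Fin N → FileData K t (numSub K t Ω δ) b) (dem : Fin K → Fin N)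
    (y : p.Stream η k) : Bits b :=
  p.codeword W dem y.1.1 y.1.2.2.1 y.1.2.2.2

/-- The law `CN(0,1)`: independent real and imaginary parts of mean `0` and variance `1/2`. -/
noncomputable def complexGaussian : Measure ℂ :=
  Measure.map (fun x : ℝ × ℝ => (x.1 : ℂ) + (x.2 : ℂ) * Complex.I)
    ((gaussianReal 0 (1 / 2)).prod (gaussianReal 0 (1 / 2)))

/-- The joint law of the channel matrices of `K` users with `G` receive antennas each and `L`
transmit antennas: all entries are i.i.d. `CN(0,1)`. -/
noncomputable def channelLaw (K G L : ℕ) : Measure (Fin K → Fin G → Fin L → ℂ) :=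
  Measure.pi fun _ => Measure.pi fun _ => Measure.pi fun _ => complexGaussian

/-- The vector `u` is a linear receiver that decodes the stream `x₀` free of interference: if the
transmit vector is the superposition of the symbols `sym x` (the modulated codewords) with the
beamformers `w x`, `x ∈ C`, and the received vector is `y = H (∑ x ∈ C, sym x • w x) + z`, then
`uᴴ y` is the symbol `sym x₀` plus the filtered noise `uᴴ z`. -/
def DecodesLinearly {G L : ℕ} {ι : Type} (H : Matrix (Fin G) (Fin L) ℂ) (C : Finset ι)
    (w : ι → Fin L → ℂ) (u : Fin G → ℂ) (x₀ : ι) : Prop :=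
  ∀ (sym : ι → ℂ) (z : Fin G → ℂ),
    star u ⬝ᵥ (H *ᵥ (∑ x ∈ C, sym x • w x) + z) = sym x₀ + star u ⬝ᵥ z

/-! Three independent ingredients are combined.

Base schedules come from a Baranyai-type theorem. The users of the target set are added one at a
time to initially empty edges, keeping for every trace `S` the number of edges that a complete
hypergraph would have. Which edges receive the next user is first answered fractionally, by the
proportion of completions that contain this user; these fractions have integral sums over columns
and over traces, so Hall's theorem rounds them.

Delivery is bookkeeping: a user `k` and a packet `P` not cached by `k` determine the codeword index
`P ∪ {k}`, and the numbering matches its occurrences with the subpackets. All other summands of a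
codeword are cached.

For decoding, put `a = Ω - t - 1` and `β = η β₀`. A beamformer must vanish at `β` antennas of each
of the `a` target users outside its index set, which generically leaves dimension `L - aβ`.
Codewords with equal index set share that space. A set `T` recurs with period `S₀` in the table, so
it occurs at most `L - aβ` times among `η` columns as soon as `η ≤ (L - aβ) S₀`; this is the first
bound on `η`, cleared of denominators, and the second bound is `β ≤ G`. Beamformers polynomial in
the channel are given by `kernelVec`, and decodability for user `k` becomes the nonvanishing of one
determinant. A nonzero polynomial vanishes only on a null set of channels, so one good channel per
user is enough (`exists_det_effectiveChannel_ne_zero`); it is built from a system of distinct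
representatives (`exists_coordinates`), where the multiplicity bound enters Hall's condition. -/

/-! ### Regular distributions of complete uniform hypergraphs. -/

/-- Integral rounding of a fractional selection with integral sums over the classes of two
partitions. -/
theorem exists_finset_card_fiber {E ι κ : Type*} [Fintype E] [Fintype ι] [Fintype κ]
    [DecidableEq E] [DecidableEq ι] [DecidableEq κ] (p : E → ι) (q : E → κ) (x : E → ℚ)
    (hx0 : ∀ e, 0 ≤ x e) (hx1 : ∀ e, x e ≤ 1) (a : ι → ℕ) (b : κ → ℕ)
    (ha : ∀ i, ∑ e with p e = i, x e = a i) (hb : ∀ j, ∑ e with q e = j, x e = b j) :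
    ∃ F : Finset E, (∀ i, (F.filter (fun e => p e = i)).card = a i) ∧
      ∀ j, (F.filter (fun e => q e = j)).card = b j := by
  classical
  let m : ι → ℕ := fun i => (Finset.univ.filter (fun e => p e = i)).card
  have ham : ∀ i, a i ≤ m i := fun i => by
    have : (a i : ℚ) ≤ m i := by
      rw [← ha i]
      calc ∑ e with p e = i, x e ≤ ∑ e with p e = i, (1 : ℚ) :=
            Finset.sum_le_sum fun e _ => hx1 e
        _ = m i := by simp [m]
    exact_mod_cast this
  let c : ι → ℕ := fun i => m i - a i
  have hc : ∀ i, ∑ e with p e = i, (1 - x e) = c i := fun i => by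
    rw [Finset.sum_sub_distrib, ha i]
    simp only [c, Nat.cast_sub (ham i)]
    simp [m]
  -- Each `e` is matched either to a rejection slot of its `p`-class or to a selection slot of its
  -- `q`-class. Sending weight `1 - x e` to the former and `x e` to the latter is a fractional
  -- matching, which gives Hall's condition.
  let t : E → Finset ((Σ i, Fin (c i)) ⊕ (Σ j, Fin (b j))) := fun e =>
    Finset.univ.filter (fun s => Sum.elim (fun u => u.1 = p e) (fun v => v.1 = q e) s)
  have hall : ∀ X : Finset E, X.card ≤ (X.biUnion t).card := by
    intro X
    let Y : Finset ((Σ i, Fin (c i)) ⊕ (Σ j, Fin (b j))) :=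
      ((X.image p).sigma fun _ => Finset.univ).disjSum ((X.image q).sigma fun _ => Finset.univ)
    have hY : Y ⊆ X.biUnion t := by
      rintro (⟨i, s⟩ | ⟨j, s⟩) hs
      · simp only [Y, Finset.inl_mem_disjSum, Finset.mem_sigma, Finset.mem_image] at hs
        obtain ⟨⟨e, he, rfl⟩, -⟩ := hs
        simp only [Finset.mem_biUnion]
        exact ⟨e, he, by simp [t]⟩
      · simp only [Y, Finset.inr_mem_disjSum, Finset.mem_sigma, Finset.mem_image] at hs
        obtain ⟨⟨e, he, rfl⟩, -⟩ := hs
        simp only [Finset.mem_biUnion]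
        exact ⟨e, he, by simp [t]⟩
    refine le_trans ?_ (Finset.card_le_card hY)
    have hYc : Y.card = ∑ i ∈ X.image p, c i + ∑ j ∈ X.image q, b j := by
      simp [Y, Finset.card_disjSum, Finset.card_sigma]
    have h1 : ∑ e ∈ X, x e ≤ ∑ j ∈ X.image q, (b j : ℚ) := by
      rw [← Finset.sum_fiberwise_of_maps_to (g := q) (t := X.image q)
        (fun e he => Finset.mem_image_of_mem q he)]
      refine Finset.sum_le_sum fun j _ => ?_
      rw [← hb j]
      exact Finset.sum_le_sum_of_subset_of_nonneg
        (Finset.filter_subset_filter _ (Finset.subset_univ _)) fun e _ _ => hx0 e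
    have h2 : ∑ e ∈ X, (1 - x e) ≤ ∑ i ∈ X.image p, (c i : ℚ) := by
      rw [← Finset.sum_fiberwise_of_maps_to (g := p) (t := X.image p)
        (fun e he => Finset.mem_image_of_mem p he)]
      refine Finset.sum_le_sum fun i _ => ?_
      rw [← hc i]
      exact Finset.sum_le_sum_of_subset_of_nonneg
        (Finset.filter_subset_filter _ (Finset.subset_univ _)) fun e _ _ => sub_nonneg.2 (hx1 e)
    have h3 : ((X.card : ℕ) : ℚ) ≤ (Y.card : ℕ) := by
      rw [hYc]
      push_cast
      have : (X.card : ℚ) = ∑ e ∈ X, (1 - x e) + ∑ e ∈ X, x e := by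
        rw [← Finset.sum_add_distrib]; simp
      linarith
    exact_mod_cast h3
  obtain ⟨f, hfinj, hft⟩ := (Finset.all_card_le_biUnion_card_iff_exists_injective t).1 hall
  have hcard : Fintype.card E = Fintype.card ((Σ i, Fin (c i)) ⊕ (Σ j, Fin (b j))) := by
    have h3 : ((Fintype.card E : ℕ) : ℚ) =
        (Fintype.card ((Σ i, Fin (c i)) ⊕ (Σ j, Fin (b j))) : ℕ) := by
      simp only [Fintype.card_sum, Fintype.card_sigma, Fintype.card_fin]
      push_cast
      simp only [← hb, ← hc]
      rw [Finset.sum_fiberwise, Finset.sum_fiberwise, ← Finset.sum_add_distrib]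
      simp
    exact_mod_cast h3
  -- All slots are filled, so the class sizes are exact: selected elements are counted by `q`,
  -- rejected ones by `p`.
  have hfb : Function.Bijective f := (Fintype.bijective_iff_injective_and_card f).2 ⟨hfinj, hcard⟩
  have hq : ∀ j, ((Finset.univ.filter (fun e => (f e).isRight)).filter
      (fun e => q e = j)).card = b j := by
    intro j
    rw [← Finset.card_image_of_injective _ hfinj]
    have : ((Finset.univ.filter (fun e => (f e).isRight)).filter (fun e => q e = j)).image f
        = (Finset.univ : Finset (Fin (b j))).image (fun s => Sum.inr ⟨j, s⟩) := by
      ext s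
      simp only [Finset.mem_image, Finset.mem_filter, Finset.mem_univ, true_and]
      constructor
      · rintro ⟨e, ⟨he, rfl⟩, rfl⟩
        have := hft e
        rcases hfe : f e with u | ⟨j, s⟩
        · simp [hfe] at he
        · simp only [hfe, t, Finset.mem_filter, Finset.mem_univ, true_and, Sum.elim_inr] at this
          subst this
          exact ⟨s, rfl⟩
      · rintro ⟨s, rfl⟩
        obtain ⟨e, he⟩ := hfb.2 (Sum.inr ⟨j, s⟩)
        have := hft e
        simp only [he, t, Finset.mem_filter, Finset.mem_univ, true_and, Sum.elim_inr] at this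
        exact ⟨e, ⟨by simp [he], this.symm⟩, he⟩
    rw [this, Finset.card_image_of_injective]
    · simp
    · intro s s' h
      simpa using h
  have hp : ∀ i, ((Finset.univ.filter (fun e => ¬ (f e).isRight)).filter
      (fun e => p e = i)).card = c i := by
    intro i
    rw [← Finset.card_image_of_injective _ hfinj]
    have : ((Finset.univ.filter (fun e => ¬ (f e).isRight)).filter (fun e => p e = i)).image f
        = (Finset.univ : Finset (Fin (c i))).image (fun s => Sum.inl ⟨i, s⟩) := by
      ext s
      simp only [Finset.mem_image, Finset.mem_filter, Finset.mem_univ, true_and]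
      constructor
      · rintro ⟨e, ⟨he, rfl⟩, rfl⟩
        have := hft e
        rcases hfe : f e with ⟨i, s⟩ | u
        · simp only [hfe, t, Finset.mem_filter, Finset.mem_univ, true_and, Sum.elim_inl] at this
          subst this
          exact ⟨s, rfl⟩
        · simp [hfe] at he
      · rintro ⟨s, rfl⟩
        obtain ⟨e, he⟩ := hfb.2 (Sum.inl ⟨i, s⟩)
        have := hft e
        simp only [he, t, Finset.mem_filter, Finset.mem_univ, true_and, Sum.elim_inl] at this
        exact ⟨e, ⟨by simp [he], this.symm⟩, he⟩
    rw [this, Finset.card_image_of_injective]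
    · simp
    · intro s s' h
      simpa using h
  refine ⟨_, fun i => ?_, hq⟩
  have h1 : ((Finset.univ.filter (fun e => (f e).isRight)).filter (fun e => p e = i)).card +
      ((Finset.univ.filter (fun e => ¬ (f e).isRight)).filter (fun e => p e = i)).card = m i := by
    rw [Finset.filter_comm, Finset.filter_comm (p := fun e => ¬ (f e).isRight),
      Finset.card_filter_add_card_filter_not]
  have := hp i
  have := ham i
  simp only [c] at *
  omega

/-- The edges of the complete `h`-uniform hypergraph on `A` can be distributed over `M` classes of
`B` edges each, with every class regular of degree `β` (a theorem of Baranyai type). The assertion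
is the invariant for the traces of the edges on an initial part `U` of `A`. -/
theorem exists_regular_distribution {α : Type*} [Fintype α] [DecidableEq α] {n h M B β : ℕ}
    (hB : B * h = n * β) (hM : M * B = n.choose h) (A : Finset α) (hA : A.card = n)
    (U : Finset α) (hU : U ⊆ A) :
    ∃ φ : Fin M × Fin B → Finset α, (∀ e, φ e ⊆ U) ∧
      (∀ S ⊆ U, (Finset.univ.filter (fun e => φ e = S)).card =
        if S.card ≤ h then (n - U.card).choose (h - S.card) else 0) ∧
      ∀ i, ∀ k ∈ U, (Finset.univ.filter (fun e => e.1 = i ∧ k ∈ φ e)).card = β := by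
  classical
  induction U using Finset.induction_on with
  | empty =>
    refine ⟨fun _ => ∅, fun _ => le_rfl, ?_, by simp⟩
    intro S hS
    obtain rfl := Finset.subset_empty.1 hS
    simp [hM]
  | insert v U hv ih =>
    obtain ⟨φ, hφU, hcount, hreg⟩ := ih ((Finset.subset_insert _ _).trans hU)
    have hlt : U.card < n := by
      have := Finset.card_le_card hU
      rw [Finset.card_insert_of_notMem hv] at this
      omega
    obtain ⟨m, hm⟩ : ∃ m, n - U.card = m + 1 := ⟨n - U.card - 1, by omega⟩
    -- A trace that occurs has a positive binomial count; this is what puts the weights `x` below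
    -- into `[0, 1]`.
    have hbd : ∀ e, (φ e).card ≤ h ∧ h - (φ e).card ≤ m + 1 := by
      intro e
      have h1 := hcount (φ e) (hφU e)
      have h2 : 0 < (Finset.univ.filter (fun e' => φ e' = φ e)).card :=
        Finset.card_pos.2 ⟨e, by simp⟩
      rw [h1] at h2
      split_ifs at h2 with h3
      · refine ⟨h3, ?_⟩
        by_contra h4
        rw [hm, Nat.choose_eq_zero_of_lt (by omega)] at h2
        exact lt_irrefl _ h2
      · exact absurd h2 (lt_irrefl _)
    -- The trace of `e` still lacks `h - |φ e|` of the `m + 1` remaining vertices; `x e` is the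
    -- proportion of its completions that contain `v`. Regularity on `U` makes the sum over a class
    -- `β`.
    let x : Fin M × Fin B → ℚ := fun e => ((h : ℚ) - (φ e).card) / (m + 1)
    have hm0 : (0 : ℚ) < m + 1 := by positivity
    -- The number of `h`-subsets of `A` with trace `S` on `U` that contain `v`; the weights over
    -- this trace sum to it by `(m + 1) * choose m j = choose (m + 1) (j + 1) * (j + 1)`.
    let b : Finset α → ℕ := fun S =>
      if S ⊆ U ∧ S.card < h then m.choose (h - S.card - 1) else 0
    obtain ⟨F, hF1, hF2⟩ := exists_finset_card_fiber (E := Fin M × Fin B) Prod.fst φ x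
      (fun e => div_nonneg (sub_nonneg.2 (by exact_mod_cast (hbd e).1)) hm0.le)
      (fun e => by
        rw [div_le_one hm0]
        have := (hbd e)
        have h1 : h ≤ m + 1 + (φ e).card := by omega
        have h2 : (h : ℚ) ≤ m + 1 + (φ e).card := by exact_mod_cast h1
        linarith)
      (fun _ => β) b
      (fun i => by
        have h1 : ∑ e with e.1 = i, (φ e).card = U.card * β := by
          rw [Finset.sum_congr rfl fun e _ => ?_]
          rotate_left
          · exact fun e => ∑ k ∈ U, if k ∈ φ e then 1 else 0
          · rw [← Finset.card_filter, Finset.filter_mem_eq_inter,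
              Finset.inter_eq_right.2 (hφU e)]
          rw [Finset.sum_comm, Finset.card_eq_sum_ones, Finset.sum_mul]
          refine Finset.sum_congr rfl fun k hk => ?_
          rw [← Finset.card_filter, Finset.filter_filter, hreg i k hk, one_mul]
        have h2 : (Finset.univ.filter (fun e : Fin M × Fin B => e.1 = i)).card = B := by
          have : (Finset.univ.filter (fun e : Fin M × Fin B => e.1 = i)) =
              {i} ×ˢ Finset.univ := by
            ext ⟨a, b⟩; simp [eq_comm]
          rw [this]; simp
        have h1' : ∑ e with e.1 = i, ((φ e).card : ℚ) = U.card * β := by exact_mod_cast h1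
        simp only [x]
        rw [← Finset.sum_div, Finset.sum_sub_distrib, h1', Finset.sum_const, h2, nsmul_eq_mul,
          div_eq_iff hm0.ne']
        have h3 : (B : ℚ) * h = n * β := by exact_mod_cast hB
        have h4 : (n : ℚ) = m + 1 + U.card := by
          have : n = m + 1 + U.card := by omega
          exact_mod_cast this
        rw [h3, h4]; ring)
      (fun S => by
        by_cases hS : S ⊆ U
        · have h1 : ∑ e with φ e = S, x e = ∑ e with φ e = S, ((h : ℚ) - S.card) / (m + 1) :=
            Finset.sum_congr rfl fun e he => by
              simp only [Finset.mem_filter] at he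
              simp only [x, he.2]
          rw [h1, Finset.sum_const, hcount S hS, hm, nsmul_eq_mul]
          simp only [b]
          rcases lt_trichotomy S.card h with h2 | h2 | h2
          · rw [if_pos h2.le, if_pos ⟨hS, h2⟩]
            obtain ⟨j, hj⟩ : ∃ j, h = S.card + (j + 1) := ⟨h - S.card - 1, by omega⟩
            rw [show h - S.card = j + 1 by omega, show j + 1 - 1 = j by omega, hj]
            have h3 := Nat.add_one_mul_choose_eq m j
            have h4 : ((m : ℚ) + 1) * m.choose j = (m + 1).choose (j + 1) * (j + 1) := by
              exact_mod_cast h3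
            push_cast
            field_simp
            linarith
          · simp [h2]
          · rw [if_neg (by omega), if_neg (by omega)]; simp
        · rw [Finset.sum_eq_zero]
          · simp [b, hS]
          · intro e he
            simp only [Finset.mem_filter] at he
            exact absurd (he.2 ▸ hφU e) hS)
    have hvφ : ∀ e, v ∉ φ e := fun e he => hv (hφU e he)
    let ψ : Fin M × Fin B → Finset α := fun e => if e ∈ F then insert v (φ e) else φ e
    have hψ1 : ∀ e ∈ F, ψ e = insert v (φ e) := fun e he => if_pos he
    have hψ2 : ∀ e ∉ F, ψ e = φ e := fun e he => if_neg he
    refine ⟨ψ, ?_, ?_, ?_⟩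
    · intro e
      by_cases he : e ∈ F
      · rw [hψ1 e he]; exact Finset.insert_subset_insert _ (hφU e)
      · rw [hψ2 e he]; exact (hφU e).trans (Finset.subset_insert _ _)
    · intro S hS
      rw [Finset.card_insert_of_notMem hv, show n - (U.card + 1) = m by omega]
      by_cases hvS : v ∈ S
      · have hSU : S.erase v ⊆ U := by
          rw [← Finset.subset_insert_iff]; exact hS
        have h1 : (Finset.univ.filter (fun e => ψ e = S)) =
            F.filter (fun e => φ e = S.erase v) := by
          ext e
          simp only [Finset.mem_filter, Finset.mem_univ, true_and]
          constructor
          · intro h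
            have he : e ∈ F := by
              by_contra he
              rw [hψ2 e he] at h
              exact hvφ e (h ▸ hvS)
            rw [hψ1 e he] at h
            exact ⟨he, by rw [← h, Finset.erase_insert (hvφ e)]⟩
          · rintro ⟨he, h⟩
            rw [hψ1 e he, h, Finset.insert_erase hvS]
        rw [h1, hF2]
        have h2 : (S.erase v).card + 1 = S.card := Finset.card_erase_add_one hvS
        simp only [b]
        by_cases h3 : S.card ≤ h
        · rw [if_pos h3, if_pos ⟨hSU, by omega⟩]
          congr 1
          omega
        · rw [if_neg h3, if_neg (by omega)]
      · have hSU : S ⊆ U := (Finset.subset_insert_iff_of_notMem hvS).1 hS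
        have h1 : (Finset.univ.filter (fun e => ψ e = S)).card +
            (F.filter (fun e => φ e = S)).card =
            (Finset.univ.filter (fun e => φ e = S)).card := by
          rw [← Finset.card_union_of_disjoint]
          · congr 1
            ext e
            simp only [Finset.mem_filter, Finset.mem_univ, true_and, Finset.mem_union]
            by_cases he : e ∈ F
            · rw [hψ1 e he]
              have : insert v (φ e) ≠ S := fun h => hvS (h ▸ Finset.mem_insert_self _ _)
              simp [he, this]
            · simp [hψ2 e he, he]
          · rw [Finset.disjoint_left]
            intro e he he'
            simp only [Finset.mem_filter, Finset.mem_univ, true_and] at he he'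
            rw [hψ1 e he'.1] at he
            exact hvS (he ▸ Finset.mem_insert_self _ _)
        rw [hF2, hcount S hSU, hm] at h1
        simp only [b] at h1
        rcases lt_trichotomy S.card h with h2 | h2 | h2
        · rw [if_pos h2.le] at h1 ⊢
          rw [if_pos ⟨hSU, h2⟩] at h1
          obtain ⟨j, hj⟩ : ∃ j, h - S.card = j + 1 := ⟨h - S.card - 1, by omega⟩
          rw [hj, Nat.choose_succ_succ'] at h1
          rw [hj]
          simp only [Nat.add_sub_cancel] at h1
          omega
        · rw [if_neg (by omega)] at h1
          simp [h2] at h1 ⊢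
          exact h1
        · rw [if_neg (by omega), if_neg (by omega)] at h1
          rw [if_neg (by omega)]
          simpa using h1
    · intro i k hk
      rcases Finset.mem_insert.1 hk with rfl | hkU
      · rw [← hF1 i]
        congr 1
        ext e
        simp only [Finset.mem_filter, Finset.mem_univ, true_and]
        by_cases he : e ∈ F
        · simp [hψ1 e he, he]
        · simp [hψ2 e he, he, hvφ e]
      · rw [← hreg i k hkU]
        congr 1
        ext e
        simp only [Finset.mem_filter, Finset.mem_univ, true_and]
        have hkv : k ≠ v := fun h => hv (h ▸ hkU)
        by_cases he : e ∈ F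
        · simp [hψ1 e he, hkv]
        · simp [hψ2 e he]

/-! ### Base schedules and numberings of subpackets. -/

theorem beta0_pos (t Ω : ℕ) : 0 < beta0 t Ω :=
  Nat.div_pos (Nat.le_of_dvd t.succ_pos (Nat.gcd_dvd_left _ _))
    (Nat.gcd_pos_of_pos_left _ t.succ_pos)

theorem B0_mul (t Ω : ℕ) : B0 t Ω * (t + 1) = Ω * beta0 t Ω := by
  unfold B0 beta0
  rw [← Nat.mul_div_assoc _ (Nat.gcd_dvd_left _ _), Nat.div_mul_right_comm (Nat.gcd_dvd_right _ _)]

/-- Dividing `(t+1) * choose Ω (t+1) = Ω * choose (Ω-1) t` by the gcd shows that `B₀` divides `β₀ *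
choose Ω (t+1)`, and `B₀` is coprime to `β₀`. -/
theorem S0_mul_B0 {t Ω : ℕ} (h : t + 1 ≤ Ω) : S0 t Ω * B0 t Ω = Ω.choose (t + 1) := by
  refine Nat.div_mul_cancel ?_
  have hg : 0 < Nat.gcd (t + 1) Ω := Nat.gcd_pos_of_pos_left _ t.succ_pos
  have hcop : Nat.Coprime (beta0 t Ω) (B0 t Ω) := Nat.coprime_div_gcd_div_gcd hg
  refine hcop.symm.dvd_of_dvd_mul_left (n := Ω.choose (t + 1)) ?_
  refine ⟨(Ω - 1).choose t, ?_⟩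
  obtain ⟨n, rfl⟩ : ∃ n, Ω = n + 1 := ⟨Ω - 1, by omega⟩
  have h1 := Nat.add_one_mul_choose_eq n t
  have h2 := B0_mul t (n + 1)
  simp only [Nat.add_sub_cancel]
  have h3 : 0 < t + 1 := t.succ_pos
  refine Nat.eq_of_mul_eq_mul_left h3 ?_
  calc (t + 1) * (beta0 t (n + 1) * (n + 1).choose (t + 1))
      = beta0 t (n + 1) * ((n + 1).choose (t + 1) * (t + 1)) := by ring
    _ = (n + 1) * beta0 t (n + 1) * n.choose t := by rw [← h1]; ring
    _ = (t + 1) * (B0 t (n + 1) * n.choose t) := by rw [← h2]; ring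

/-- Once the initial part is all of `A`, the trace counts are `choose 0 (t + 1 - |S|)`: every
`(t+1)`-subset occurs exactly once and nothing else occurs. Covering follows from regularity since
`β₀ > 0`. -/
theorem nonempty_baseSchedule {K t Ω : ℕ} (h : t + 1 ≤ Ω) (A : TargetSet K Ω) :
    Nonempty (BaseSchedule t Ω A) := by
  classical
  obtain ⟨φ, hφ, hcount, hreg⟩ := exists_regular_distribution (B0_mul t Ω) (S0_mul_B0 h) A.1 A.2
    A.1 le_rfl
  rw [A.2, Nat.sub_self] at hcount
  have hcard : ∀ e, (φ e).card = t + 1 := by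
    intro e
    have h1 := hcount (φ e) (hφ e)
    have h2 : 0 < (Finset.univ.filter (fun e' => φ e' = φ e)).card :=
      Finset.card_pos.2 ⟨e, by simp⟩
    rw [h1] at h2
    split_ifs at h2 with h3
    · by_contra h4
      rw [Nat.choose_eq_zero_of_lt (by omega)] at h2
      exact lt_irrefl _ h2
    · exact absurd h2 (lt_irrefl _)
  have huniq : ∀ S ⊆ A.1, S.card = t + 1 → ∃! e, φ e = S := by
    intro S hS hSc
    have h1 := hcount S hS
    rw [if_pos hSc.le, hSc, Nat.sub_self, Nat.choose_zero_right, Finset.card_eq_one] at h1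
    obtain ⟨e, he⟩ := h1
    have h2 : ∀ e', φ e' = S ↔ e' = e := fun e' => by
      have := Finset.ext_iff.1 he e'
      simpa using this
    exact ⟨e, (h2 e).2 rfl, fun e' he' => (h2 e').1 he'⟩
  have hinj : Function.Injective φ := fun e e' he =>
    (huniq (φ e) (hφ e) (hcard e)).unique rfl he.symm
  let col : Fin (S0 t Ω) → Finset (CodewordIdx K t) := fun s =>
    Finset.univ.image fun b => ⟨φ (s, b), hcard _⟩
  have hmem : ∀ s T, T ∈ col s ↔ ∃ b, φ (s, b) = T.1 := fun s T => by
    simp [col, Subtype.ext_iff]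
  have hregular : ∀ s, ∀ k ∈ A.1,
      ((col s).filter (fun T => k ∈ T.1)).card = beta0 t Ω := by
    intro s k hk
    rw [← hreg s k hk]
    symm
    refine Finset.card_bij (fun e _ => ⟨φ e, hcard e⟩) ?_ ?_ ?_
    · rintro ⟨s', b⟩ he
      simp only [Finset.mem_filter, Finset.mem_univ, true_and] at he
      simp only [Finset.mem_filter, hmem]
      exact ⟨⟨b, by rw [he.1]⟩, he.2⟩
    · intro e _ e' _ hee
      exact hinj (Subtype.ext_iff.1 hee)
    · intro T hT
      simp only [Finset.mem_filter, hmem] at hT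
      obtain ⟨⟨b, hb⟩, hk⟩ := hT
      exact ⟨(s, b), by simp [hb, hk], Subtype.ext hb⟩
  refine ⟨⟨col, ?_, ?_, ?_, hregular⟩⟩
  · intro s T hT
    obtain ⟨b, hb⟩ := (hmem s T).1 hT
    exact hb ▸ hφ _
  · intro T hT
    obtain ⟨⟨s, b⟩, he, hu⟩ := huniq T.1 hT T.2
    refine ⟨s, (hmem s T).2 ⟨b, he⟩, fun s' hs' => ?_⟩
    obtain ⟨b', hb'⟩ := (hmem s' T).1 hs'
    exact congrArg Prod.fst (hu (s', b') hb')
  · intro s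
    ext k
    simp only [Finset.mem_biUnion]
    constructor
    · rintro ⟨T, hT, hk⟩
      obtain ⟨b, hb⟩ := (hmem s T).1 hT
      exact hφ (s, b) (hb ▸ hk)
    · intro hk
      have h1 : 0 < ((col s).filter (fun T => k ∈ T.1)).card := by
        rw [hregular s k hk]; exact beta0_pos t Ω
      obtain ⟨T, hT⟩ := Finset.card_pos.1 h1
      exact ⟨T, (Finset.mem_filter.1 hT).1, (Finset.mem_filter.1 hT).2⟩

theorem card_targetSet_superset {K t Ω : ℕ} (h : t + 1 ≤ Ω) (T : CodewordIdx K t) :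
    (Finset.univ.filter (fun A : TargetSet K Ω => T.1 ⊆ A.1)).card =
      (K - t - 1).choose (Ω - t - 1) := by
  classical
  have h1 : (Finset.powersetCard (Ω - t - 1) (T.1)ᶜ).card = (K - t - 1).choose (Ω - t - 1) := by
    rw [Finset.card_powersetCard, Finset.card_compl, T.2, Fintype.card_fin]
    rfl
  rw [← h1]
  refine Finset.card_bij (fun A _ => A.1 \ T.1) ?_ ?_ ?_
  · intro A hA
    simp only [Finset.mem_filter, Finset.mem_univ, true_and] at hA
    rw [Finset.mem_powersetCard]
    refine ⟨fun x hx => by simpa using (Finset.mem_sdiff.1 hx).2, ?_⟩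
    rw [Finset.card_sdiff_of_subset hA, A.2, T.2, Nat.sub_sub]
  · intro A hA A' hA' hh
    simp only [Finset.mem_filter, Finset.mem_univ, true_and] at hA hA'
    refine Subtype.ext ?_
    rw [← Finset.sdiff_union_of_subset hA, hh, Finset.sdiff_union_of_subset hA']
  · intro R hR
    rw [Finset.mem_powersetCard] at hR
    have hdis : Disjoint R T.1 := by
      rw [Finset.disjoint_left]
      intro x hx hx'
      have := hR.1 hx
      simp [hx'] at this
    refine ⟨⟨R ∪ T.1, ?_⟩, ?_, ?_⟩
    · rw [Finset.card_union_of_disjoint hdis, hR.2, T.2]; omega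
    · simp
    · simp only
      rw [Finset.union_sdiff_right, Finset.sdiff_eq_self_of_disjoint hdis]

theorem nonempty_deliveryPlan {K t Ω δ : ℕ} (h : t + 1 ≤ Ω) (hK : Ω ≤ K) (hδ : 0 < δ) :
    Nonempty (DeliveryPlan K t Ω δ) := by
  classical
  have hpos : 0 < numSub K t Ω δ := Nat.mul_pos hδ (Nat.choose_pos (by omega))
  have hlab : ∀ T : CodewordIdx K t, ∃ f : TargetSet K Ω × Fin δ → Fin (numSub K t Ω δ),
      Set.BijOn f {x | T.1 ⊆ x.1.1} Set.univ := by
    intro T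
    have hc : Fintype.card {x : TargetSet K Ω × Fin δ // T.1 ⊆ x.1.1} =
        Fintype.card (Fin (numSub K t Ω δ)) := by
      rw [Fintype.card_subtype, Fintype.card_fin, numSub, ← card_targetSet_superset h T]
      have : (Finset.univ.filter (fun x : TargetSet K Ω × Fin δ => T.1 ⊆ x.1.1)) =
          (Finset.univ.filter (fun A : TargetSet K Ω => T.1 ⊆ A.1)) ×ˢ Finset.univ := by
        ext x; simp
      rw [this, Finset.card_product, Finset.card_univ, Fintype.card_fin, mul_comm]
    let e := Fintype.equivOfCardEq hc
    -- Target sets not containing `T` get the irrelevant label `0`.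
    refine ⟨fun x => if hx : T.1 ⊆ x.1.1 then e ⟨x, hx⟩ else ⟨0, hpos⟩, fun _ _ => trivial, ?_, ?_⟩
    · intro x hx y hy hxy
      replace hx : T.1 ⊆ x.1.1 := hx
      replace hy : T.1 ⊆ y.1.1 := hy
      simp only [dif_pos hx, dif_pos hy] at hxy
      exact congrArg Subtype.val (e.injective hxy)
    · intro q _
      refine ⟨(e.symm q).1, (e.symm q).2, ?_⟩
      simp only [dif_pos (e.symm q).2]
      exact e.apply_symm_apply q
  choose f hf using hlab
  exact ⟨⟨fun A => (nonempty_baseSchedule h A).some, fun T A d => f T (A, d), hf⟩⟩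

/-! ### Blocks of the table and recovery of the files. -/

namespace DeliveryPlan

variable {K t Ω δ : ℕ} (p : DeliveryPlan K t Ω δ) {η : ℕ}

theorem mem_block {A : TargetSet K Ω} {r : Fin (δ * S0 t Ω / η)}
    {x : Fin δ × CodewordIdx K t} :
    x ∈ p.block η A r ↔
      ∃ s : Fin (S0 t Ω), x.2 ∈ (p.base A).column s ∧ (S0 t Ω * x.1.1 + s.1) / η = r.1 := by
  obtain ⟨d, T⟩ := x
  simp only [block, Finset.mem_biUnion, Finset.mem_filter, Finset.mem_univ, true_and,
    Finset.mem_image, Prod.mk.injEq, Prod.exists]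
  constructor
  · rintro ⟨d', s, h1, T', h2, rfl, rfl⟩
    exact ⟨s, h2, h1⟩
  · rintro ⟨s, h2, h1⟩
    exact ⟨d, s, h1, T, h2, rfl, rfl⟩

theorem subset_of_mem_block {A : TargetSet K Ω} {r : Fin (δ * S0 t Ω / η)}
    {x : Fin δ × CodewordIdx K t} (hx : x ∈ p.block η A r) : x.2.1 ⊆ A.1 := by
  obtain ⟨s, hs, -⟩ := p.mem_block.1 hx
  exact (p.base A).subset_target s _ hs

theorem block_unique {A : TargetSet K Ω} {r r' : Fin (δ * S0 t Ω / η)}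
    {x : Fin δ × CodewordIdx K t} (hx : x ∈ p.block η A r) (hx' : x ∈ p.block η A r') :
    r = r' := by
  obtain ⟨s, hs, h⟩ := p.mem_block.1 hx
  obtain ⟨s', hs', h'⟩ := p.mem_block.1 hx'
  obtain rfl := ((p.base A).partition x.2 (p.subset_of_mem_block hx)).unique hs hs'
  exact Fin.ext (h ▸ h')

theorem exists_mem_block (hdvd : η ∣ δ * S0 t Ω) {A : TargetSet K Ω}
    {x : Fin δ × CodewordIdx K t} (hx : x.2.1 ⊆ A.1) : ∃ r, x ∈ p.block η A r := by
  obtain ⟨s, hs, -⟩ := (p.base A).partition x.2 hx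
  have h1 : S0 t Ω * x.1.1 + s.1 < δ * S0 t Ω := by
    calc S0 t Ω * x.1.1 + s.1 < S0 t Ω * x.1.1 + S0 t Ω := by have := s.2; omega
      _ = (x.1.1 + 1) * S0 t Ω := by ring
      _ ≤ δ * S0 t Ω := Nat.mul_le_mul_right _ x.1.2
  exact ⟨⟨(S0 t Ω * x.1.1 + s.1) / η, Nat.div_lt_div_of_lt_of_dvd hdvd h1⟩,
    p.mem_block.2 ⟨s, hs, rfl⟩⟩

theorem card_columns_block (hη : 0 < η) (r : Fin (δ * S0 t Ω / η)) :
    ((Finset.univ : Finset (Fin δ × Fin (S0 t Ω))).filter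
      (fun c => (S0 t Ω * c.1.1 + c.2.1) / η = r.1)).card = η := by
  classical
  have h1 : (Finset.Ico (r.1 * η) ((r.1 + 1) * η)).card = η := by
    rw [Nat.card_Ico, Nat.succ_mul]; omega
  have hr : (r.1 + 1) * η ≤ δ * S0 t Ω :=
    (Nat.mul_le_mul_right η r.2).trans (Nat.div_mul_le_self _ _)
  have key : ∀ z, z / η = r.1 ↔ z ∈ Finset.Ico (r.1 * η) ((r.1 + 1) * η) := by
    intro z
    rw [Finset.mem_Ico, Nat.div_eq_iff hη, Nat.succ_mul]
    omega
  refine Eq.trans ?_ h1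
  refine Finset.card_bij (fun c _ => ((finProdFinEquiv c : Fin (δ * S0 t Ω)) : ℕ)) ?_ ?_ ?_
  · intro c hc
    rw [← key, finProdFinEquiv_apply_val, add_comm]
    simpa using hc
  · intro c _ c' _ hcc
    exact finProdFinEquiv.injective (Fin.ext hcc)
  · intro z hz
    have hz' : z < δ * S0 t Ω := lt_of_lt_of_le (Finset.mem_Ico.1 hz).2 hr
    refine ⟨finProdFinEquiv.symm ⟨z, hz'⟩, ?_, by simp [Nat.mod_add_div]⟩
    have h2 := finProdFinEquiv_apply_val (finProdFinEquiv.symm (⟨z, hz'⟩ : Fin (δ * S0 t Ω)))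
    rw [Equiv.apply_symm_apply] at h2
    simp only [Finset.mem_filter, Finset.mem_univ, true_and]
    rw [key, add_comm (S0 t Ω * _), ← h2]
    exact hz

theorem card_filter_block (hη : 0 < η) (A : TargetSet K Ω) (r : Fin (δ * S0 t Ω / η))
    {k : Fin K} (hk : k ∈ A.1) :
    ((p.block η A r).filter (fun x => k ∈ x.2.1)).card = η * beta0 t Ω := by
  classical
  rw [block, Finset.filter_biUnion, Finset.card_biUnion]
  · rw [Finset.sum_congr rfl fun c _ => ?_, Finset.sum_const, card_columns_block hη, smul_eq_mul]
    rw [Finset.filter_image, Finset.card_image_of_injective _ (Prod.mk_right_injective _)]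
    exact (p.base A).regular c.2 k hk
  · rintro ⟨d, s⟩ _ ⟨d', s'⟩ _ hne
    refine Finset.disjoint_left.2 ?_
    rintro ⟨e, T⟩ h1 h2
    simp only [Finset.mem_filter, Finset.mem_image, Prod.mk.injEq] at h1 h2
    obtain ⟨⟨T1, hT1, rfl, rfl⟩, -⟩ := h1
    obtain ⟨⟨T2, hT2, rfl, rfl⟩, -⟩ := h2
    exact hne (Prod.ext rfl (((p.base A).partition T2 ((p.base A).subset_target s _ hT1)).unique
      hT1 hT2))

/-- The copies of one index set lie exactly `S₀` columns apart, so a window of at most `X * S₀`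
consecutive columns meets at most `X` of them. This multiplicity bound is what beamforming needs. -/
theorem card_filter_eq_block (hη : 0 < η) {A : TargetSet K Ω} {r : Fin (δ * S0 t Ω / η)}
    {X : ℕ} (hX : η ≤ X * S0 t Ω) {x : Fin δ × CodewordIdx K t} (hx : x ∈ p.block η A r) :
    ((p.block η A r).filter (fun y => y.2 = x.2)).card ≤ X := by
  classical
  obtain ⟨s, hs, -⟩ := p.mem_block.1 hx
  let F := (p.block η A r).filter (fun y => y.2 = x.2)
  have hF : ∀ y ∈ F, y.2 = x.2 ∧ (S0 t Ω * y.1.1 + s.1) / η = r.1 := by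
    intro y hy
    obtain ⟨hy1, hy2⟩ := Finset.mem_filter.1 hy
    obtain ⟨s', hs', h⟩ := p.mem_block.1 hy1
    rw [hy2] at hs'
    obtain rfl := ((p.base A).partition x.2 (p.subset_of_mem_block hx)).unique hs hs'
    exact ⟨hy2, h⟩
  have hne : F.Nonempty := ⟨x, Finset.mem_filter.2 ⟨hx, rfl⟩⟩
  obtain ⟨y₀, hy₀, hmin⟩ := Finset.exists_min_image F (fun y => y.1.1) hne
  calc F.card ≤ (Finset.range X).card := by
        refine Finset.card_le_card_of_injOn (fun y => y.1.1 - y₀.1.1) ?_ ?_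
        · intro y hy
          have h1 := (hF y hy).2
          have h0 := (hF y₀ hy₀).2
          have hle := hmin y hy
          rw [Nat.div_eq_iff hη] at h1 h0
          obtain ⟨a, ha⟩ : ∃ a, y.1.1 = y₀.1.1 + a := ⟨y.1.1 - y₀.1.1, by omega⟩
          simp only [Finset.coe_range, Set.mem_Iio]
          rw [ha, Nat.add_sub_cancel_left]
          rw [ha, mul_add] at h1
          by_contra hcon
          have : X * S0 t Ω ≤ S0 t Ω * a := by
            rw [mul_comm]; exact Nat.mul_le_mul_left _ (not_lt.1 hcon)
          omega
        · intro y hy y' hy' hyy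
          have h1 := hmin y hy
          have h2 := hmin y' hy'
          simp only at hyy
          exact Prod.ext (Fin.ext (by omega)) ((hF y hy).1.trans (hF y' hy').1.symm)
    _ = X := Finset.card_range X

/-- The packet together with `k` recovers `T`, the label then recovers the target set and copy, and
these determine the block. -/
theorem subpacketOf_injective (k : Fin K) :
    Function.Injective (p.subpacketOf (η := η) (k := k)) := by
  rintro ⟨⟨A, r, d, T⟩, hy, hk⟩ ⟨⟨A', r', d', T'⟩, hy', hk'⟩ h
  simp only [subpacketOf, Prod.mk.injEq, CodewordIdx.packet, Subtype.mk.injEq] at h hk hk'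
  obtain ⟨h1, h2⟩ := h
  have hT : T = T' := by
    refine Subtype.ext ?_
    rw [← Finset.insert_erase hk, h1, Finset.insert_erase hk']
  subst hT
  have h3 := (p.label_bijOn T).injOn (x₁ := (A, d)) (x₂ := (A', d'))
    (p.subset_of_mem_block hy) (p.subset_of_mem_block hy') h2
  obtain ⟨rfl, rfl⟩ := Prod.mk.inj h3
  obtain rfl := p.block_unique hy hy'
  rfl

theorem notMem_subpacketOf {k : Fin K} (y : p.Stream η k) : k ∉ (p.subpacketOf y).1.1 := by
  simp [subpacketOf, CodewordIdx.packet]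

theorem exists_stream (hdvd : η ∣ δ * S0 t Ω) {k : Fin K} {P : PacketIdx K t}
    (hP : k ∉ P.1) (q : Fin (numSub K t Ω δ)) :
    ∃ y : p.Stream η k, p.subpacketOf y = (P, q) := by
  let T : CodewordIdx K t := ⟨insert k P.1, by rw [Finset.card_insert_of_notMem hP, P.2]⟩
  obtain ⟨⟨A, d⟩, hA, hq⟩ := (p.label_bijOn T).surjOn (Set.mem_univ q)
  obtain ⟨r, hr⟩ := p.exists_mem_block hdvd (x := (d, T)) hA
  refine ⟨⟨(A, r, d, T), hr, Finset.mem_insert_self _ _⟩, Prod.ext (Subtype.ext ?_) hq⟩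
  exact Finset.erase_insert hP

/-- The subpacket decoded by user `k` from a codeword: the other summands are cached. -/
theorem exists_decoder {N b : ℕ} (dem : Fin K → Fin N) {k : Fin K} (y : p.Stream η k) :
    ∃ dec : CacheData K N t (numSub K t Ω δ) b k → Bits b → Bits b,
      ∀ W : Fin N → FileData K t (numSub K t Ω δ) b,
        dec (cacheOf W k) (p.codewordOf W dem y) =
          W (dem k) (p.subpacketOf y).1 (p.subpacketOf y).2 := by
  classical
  obtain ⟨⟨A, r, d, T⟩, hy, hk⟩ := y
  have hmem : ∀ k' : {k' // k' ∈ T.1}, k' ≠ ⟨k, hk⟩ → k ∈ (T.packet k'.1 k'.2).1 :=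
    fun k' hne => Finset.mem_erase.2 ⟨fun h => hne (Subtype.ext h.symm), hk⟩
  refine ⟨fun c s => s - ∑ k' : {k' // k' ∈ T.1}, if h : k' ≠ ⟨k, hk⟩ then
    c (dem k'.1) ⟨T.packet k'.1 k'.2, hmem k' h⟩ (p.label T A d) else 0, fun W => ?_⟩
  simp only [codewordOf, codeword, subpacketOf, cacheOf]
  rw [sub_eq_iff_eq_add, ← Finset.add_sum_erase _ _ (Finset.mem_univ (⟨k, hk⟩ : {k' // k' ∈ T.1}))]
  congr 1
  rw [← Finset.add_sum_erase _ _ (Finset.mem_univ (⟨k, hk⟩ : {k' // k' ∈ T.1})), dif_neg (by simp),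
    zero_add]
  refine Finset.sum_congr rfl fun k' hk' => ?_
  rw [dif_pos (Finset.ne_of_mem_erase hk')]

theorem exists_file_decoder (hdvd : η ∣ δ * S0 t Ω) {N b : ℕ}
    (dem : Fin K → Fin N) (k : Fin K) :
    ∃ dec : CacheData K N t (numSub K t Ω δ) b k → (p.Stream η k → Bits b) →
        FileData K t (numSub K t Ω δ) b,
      ∀ W : Fin N → FileData K t (numSub K t Ω δ) b,
        dec (cacheOf W k) (fun y => p.codewordOf W dem y) = W (dem k) := by
  choose dec hdec using fun y : p.Stream η k => p.exists_decoder (b := b) dem y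
  choose str hstr using fun (P : PacketIdx K t) (hP : k ∉ P.1) q =>
    p.exists_stream hdvd hP q
  refine ⟨fun c s P q => if hP : k ∈ P.1 then c (dem k) ⟨P, hP⟩ q
    else dec (str P hP q) c (s (str P hP q)), fun W => ?_⟩
  funext P q
  by_cases hP : k ∈ P.1
  · simp only [dif_pos hP, cacheOf]
  · simp only [dif_neg hP, hdec, hstr]

end DeliveryPlan

/-! ### Polynomial functions and their null zero sets. -/

/-- The measurable functions on a complex vector space that are polynomial along every line. -/
def linewisePolynomial (E : Type*) [AddCommGroup E] [Module ℂ E] [MeasurableSpace E] :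
    Subalgebra ℂ (E → ℂ) where
  carrier := {f | Measurable f ∧ ∀ a b : E, ∃ P : Polynomial ℂ, ∀ s : ℂ, f (a + s • b) = P.eval s}
  mul_mem' := by
    rintro f g ⟨hf, hf'⟩ ⟨hg, hg'⟩
    refine ⟨hf.mul hg, fun a b => ?_⟩
    obtain ⟨P, hP⟩ := hf' a b
    obtain ⟨Q, hQ⟩ := hg' a b
    exact ⟨P * Q, fun s => by simp [hP, hQ]⟩
  add_mem' := by
    rintro f g ⟨hf, hf'⟩ ⟨hg, hg'⟩
    refine ⟨hf.add hg, fun a b => ?_⟩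
    obtain ⟨P, hP⟩ := hf' a b
    obtain ⟨Q, hQ⟩ := hg' a b
    exact ⟨P + Q, fun s => by simp [hP, hQ]⟩
  algebraMap_mem' := fun c =>
    ⟨measurable_const, fun _ _ => ⟨Polynomial.C c, fun _ => by simp⟩⟩

namespace linewisePolynomial

variable {E F : Type*} [AddCommGroup E] [Module ℂ E] [MeasurableSpace E]
  [AddCommGroup F] [Module ℂ F] [MeasurableSpace F]

theorem linear_mem {φ : E → ℂ} (hm : Measurable φ)
    (h : ∀ a b (s : ℂ), φ (a + s • b) = φ a + s * φ b) : φ ∈ linewisePolynomial E :=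
  ⟨hm, fun a b => ⟨Polynomial.C (φ a) + Polynomial.X * Polynomial.C (φ b), fun s => by
    rw [h, Polynomial.eval_add, Polynomial.eval_mul, Polynomial.eval_X, Polynomial.eval_C,
      Polynomial.eval_C]⟩⟩

theorem const_mem (c : ℂ) : (fun _ : E => c) ∈ linewisePolynomial E :=
  (linewisePolynomial E).algebraMap_mem c

theorem comp_mem {f : E → ℂ} (hf : f ∈ linewisePolynomial E) {g : F → E} (hg : Measurable g)
    (h : ∀ a b, ∃ a' b', ∀ s : ℂ, g (a + s • b) = a' + s • b') :
    (fun x => f (g x)) ∈ linewisePolynomial F := by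
  refine ⟨hf.1.comp hg, fun a b => ?_⟩
  obtain ⟨a', b', h'⟩ := h a b
  obtain ⟨P, hP⟩ := hf.2 a' b'
  exact ⟨P, fun s => by simp only [h', hP]⟩

theorem sum_mem {ι : Type*} (s : Finset ι) {f : ι → E → ℂ}
    (hf : ∀ i ∈ s, f i ∈ linewisePolynomial E) :
    (fun x => ∑ i ∈ s, f i x) ∈ linewisePolynomial E := by
  have := (linewisePolynomial E).sum_mem hf
  convert this using 1
  funext x
  simp

theorem prod_mem {ι : Type*} (s : Finset ι) {f : ι → E → ℂ}
    (hf : ∀ i ∈ s, f i ∈ linewisePolynomial E) :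
    (fun x => ∏ i ∈ s, f i x) ∈ linewisePolynomial E := by
  have := (linewisePolynomial E).prod_mem hf
  convert this using 1
  funext x
  simp

theorem mul_mem {f g : E → ℂ} (hf : f ∈ linewisePolynomial E) (hg : g ∈ linewisePolynomial E) :
    (fun x => f x * g x) ∈ linewisePolynomial E :=
  (linewisePolynomial E).mul_mem hf hg

theorem sub_mem {f g : E → ℂ} (hf : f ∈ linewisePolynomial E) (hg : g ∈ linewisePolynomial E) :
    (fun x => f x - g x) ∈ linewisePolynomial E :=
  (linewisePolynomial E).sub_mem hf hg

theorem det_mem {m : Type*} [Fintype m] [DecidableEq m] {B : E → Matrix m m ℂ}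
    (hB : ∀ i j, (fun x => B x i j) ∈ linewisePolynomial E) :
    (fun x => (B x).det) ∈ linewisePolynomial E := by
  simp only [Matrix.det_apply']
  exact sum_mem _ fun σ _ => mul_mem (const_mem _) (prod_mem _ fun i _ => hB _ _)

theorem adjugate_mem {m : Type*} [Fintype m] [DecidableEq m] {B : E → Matrix m m ℂ}
    (hB : ∀ i j, (fun x => B x i j) ∈ linewisePolynomial E) (i j : m) :
    (fun x => (B x).adjugate i j) ∈ linewisePolynomial E := by
  simp only [Matrix.adjugate_apply]
  refine det_mem fun i' j' => ?_
  by_cases h : i' = j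
  · subst h
    simpa using const_mem _
  · simpa [Matrix.updateRow_ne h] using hB i' j'

theorem matrix_mul_mem {l m n : Type*} [Fintype m] {B : E → Matrix l m ℂ} {C : E → Matrix m n ℂ}
    (hB : ∀ i j, (fun x => B x i j) ∈ linewisePolynomial E)
    (hC : ∀ i j, (fun x => C x i j) ∈ linewisePolynomial E) (i : l) (j : n) :
    (fun x => (B x * C x) i j) ∈ linewisePolynomial E := by
  simp only [Matrix.mul_apply]
  exact sum_mem _ fun k _ => mul_mem (hB _ _) (hC _ _)

theorem mulVec_mem {m n : Type*} [Fintype n] {B : E → Matrix m n ℂ} {v : E → n → ℂ}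
    (hB : ∀ i j, (fun x => B x i j) ∈ linewisePolynomial E)
    (hv : ∀ j, (fun x => v x j) ∈ linewisePolynomial E) (i : m) :
    (fun x => (B x *ᵥ v x) i) ∈ linewisePolynomial E := by
  simp only [Matrix.mulVec, dotProduct]
  exact sum_mem _ fun k _ => mul_mem (hB _ _) (hv _)

/-- On the line through a nonzero of `f` and a nonzero of `g`, both restrict to nonzero polynomials
in one variable, whose product is nonzero. -/
theorem exists_mul_ne_zero {f g : E → ℂ} (hf : f ∈ linewisePolynomial E)
    (hg : g ∈ linewisePolynomial E) (hf0 : ∃ a, f a ≠ 0) (hg0 : ∃ a, g a ≠ 0) :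
    ∃ a, f a * g a ≠ 0 := by
  obtain ⟨a, ha⟩ := hf0
  obtain ⟨b, hb⟩ := hg0
  obtain ⟨P, hP⟩ := hf.2 a (b - a)
  obtain ⟨Q, hQ⟩ := hg.2 a (b - a)
  by_contra! hcon
  have hPQ : P * Q = 0 := Polynomial.funext fun s => by
    rw [Polynomial.eval_mul, ← hP, ← hQ, hcon, Polynomial.eval_zero]
  rcases mul_eq_zero.1 hPQ with h | h
  · exact ha (by simpa [h] using hP 0)
  · exact hb (by simpa [h] using hQ 1)

theorem exists_forall_ne_zero {ι : Type*} (s : Finset ι) {f : ι → E → ℂ}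
    (hf : ∀ i ∈ s, f i ∈ linewisePolynomial E) (hf0 : ∀ i ∈ s, ∃ a, f i a ≠ 0) :
    ∃ a, ∀ i ∈ s, f i a ≠ 0 := by
  classical
  suffices h : ∃ a, ∏ i ∈ s, f i a ≠ 0 by
    obtain ⟨a, ha⟩ := h
    exact ⟨a, Finset.prod_ne_zero_iff.1 ha⟩
  induction s using Finset.induction_on with
  | empty => exact ⟨0, by simp⟩
  | insert i s hi ih =>
    have h1 := ih (fun j hj => hf j (Finset.mem_insert_of_mem hj))
      (fun j hj => hf0 j (Finset.mem_insert_of_mem hj))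
    obtain ⟨a, ha⟩ := exists_mul_ne_zero (hf i (Finset.mem_insert_self _ _))
      (prod_mem s fun j hj => hf j (Finset.mem_insert_of_mem hj))
      (hf0 i (Finset.mem_insert_self _ _)) h1
    exact ⟨a, by rwa [Finset.prod_insert hi]⟩

end linewisePolynomial

/-- A measure under which every nonzero linewise polynomial is almost everywhere nonzero. -/
def AvoidsPolynomialZeros {E : Type*} [AddCommGroup E] [Module ℂ E] [MeasurableSpace E]
    (μ : Measure E) : Prop :=
  ∀ f ∈ linewisePolynomial E, (∃ a, f a ≠ 0) → ∀ᵐ x ∂μ, f x ≠ 0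

theorem AvoidsPolynomialZeros.of_nullSingleton (μ : Measure ℂ) [NullSingletonClass μ] :
    AvoidsPolynomialZeros μ := by
  rintro f ⟨-, hf⟩ ⟨a, ha⟩
  obtain ⟨P, hP⟩ := hf 0 1
  have hP' : ∀ s, f s = P.eval s := fun s => by simpa using hP s
  have hP0 : P ≠ 0 := by
    rintro rfl
    exact ha (by simp [hP'])
  have hfin : {s | f s = 0}.Finite := by
    refine (Polynomial.finite_setOfPred_isRoot hP0).subset fun s hs => ?_
    have hs' : f s = 0 := hs
    rw [hP'] at hs'
    exact hs'
  rw [ae_iff]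
  simpa using hfin.measure_zero μ

/-- Fubini: the slice `f (·, b)` is nonzero for almost every `x`, and for each such `x` the slice `f
(x, ·)` is not identically zero. -/
theorem AvoidsPolynomialZeros.prod {E F : Type*} [AddCommGroup E] [Module ℂ E]
    [MeasurableSpace E] [AddCommGroup F] [Module ℂ F] [MeasurableSpace F] {μ : Measure E}
    {ν : Measure F} [SFinite ν] (hμ : AvoidsPolynomialZeros μ) (hν : AvoidsPolynomialZeros ν) :
    AvoidsPolynomialZeros (μ.prod ν) := by
  rintro f hf ⟨⟨a, b⟩, hab⟩
  have hmeas : MeasurableSet {z | f z ≠ 0} := hf.1 (measurableSet_singleton 0).compl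
  rw [Measure.ae_prod_iff_ae_ae hmeas]
  have h1 : (fun x => f (x, b)) ∈ linewisePolynomial E :=
    linewisePolynomial.comp_mem hf measurable_prodMk_right
      fun c d => ⟨(c, b), (d, 0), fun s => by simp⟩
  filter_upwards [hμ _ h1 ⟨a, hab⟩] with x hx
  have h2 : (fun y => f (x, y)) ∈ linewisePolynomial F :=
    linewisePolynomial.comp_mem hf measurable_prodMk_left
      fun c d => ⟨(x, c), (0, d), fun s => by simp⟩
  exact hν _ h2 ⟨b, hx⟩

theorem AvoidsPolynomialZeros.pi {E : Type*} [AddCommGroup E] [Module ℂ E] [MeasurableSpace E]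
    {μ : Measure E} [SigmaFinite μ] (hμ : AvoidsPolynomialZeros μ) (n : ℕ) :
    AvoidsPolynomialZeros (Measure.pi fun _ : Fin n => μ) := by
  induction n with
  | zero =>
    rintro f - ⟨a, ha⟩
    exact Filter.Eventually.of_forall fun x => Subsingleton.elim a x ▸ ha
  | succ n ih =>
    rintro f hf ⟨a, ha⟩
    let e := MeasurableEquiv.piFinSuccAbove (fun _ : Fin (n + 1) => E) 0
    have he : MeasurePreserving e (Measure.pi fun _ => μ) (μ.prod (Measure.pi fun _ => μ)) :=
      measurePreserving_piFinSuccAbove (fun _ : Fin (n + 1) => μ) 0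
    have h1 : (fun z => f (e.symm z)) ∈ linewisePolynomial (E × (Fin n → E)) := by
      refine linewisePolynomial.comp_mem hf e.symm.measurable fun c d => ⟨e.symm c, e.symm d, ?_⟩
      intro s
      rw [MeasurableEquiv.symm_apply_eq]
      refine Prod.ext ?_ ?_
      · change _ = (e.symm c + s • e.symm d) 0
        simp [e, Fin.insertNthEquiv]
      · funext i
        change _ = (e.symm c + s • e.symm d) (Fin.succAbove 0 i)
        simp [e, Fin.insertNthEquiv]
    have h2 := he.quasiMeasurePreserving.ae (hμ.prod ih _ h1 ⟨e a, by simpa using ha⟩)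
    filter_upwards [h2] with x hx
    simpa using hx

instance nullSingletonClass_complexGaussian : NullSingletonClass complexGaussian := by
  have hm : Measurable (fun x : ℝ × ℝ => (x.1 : ℂ) + (x.2 : ℂ) * Complex.I) := by fun_prop
  have : NullSingletonClass (gaussianReal 0 (1 / 2)) :=
    nullSingletonClass_gaussianReal (by simp)
  refine ⟨fun z => ?_⟩
  rw [complexGaussian, Measure.map_apply hm (measurableSet_singleton z)]
  refine measure_mono_null (t := {z.re} ×ˢ {z.im}) ?_ ?_
  · rintro ⟨a, b⟩ h
    have h' : (a : ℂ) + (b : ℂ) * Complex.I = z := h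
    simp [← h']
  · rw [Measure.prod_prod, measure_singleton, zero_mul]

instance isProbabilityMeasure_complexGaussian : IsProbabilityMeasure complexGaussian := by
  have hm : Measurable (fun x : ℝ × ℝ => (x.1 : ℂ) + (x.2 : ℂ) * Complex.I) := by fun_prop
  exact Measure.isProbabilityMeasure_map hm.aemeasurable

theorem avoidsPolynomialZeros_channelLaw (K G L : ℕ) :
    AvoidsPolynomialZeros (channelLaw K G L) :=
  (((AvoidsPolynomialZeros.of_nullSingleton complexGaussian).pi L).pi G).pi K

/-! ### Zero forcing and linear receivers. -/

/-- A vector in the kernel of `M` that depends polynomially on `M` and the parameters `N`, `v`. -/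
noncomputable def kernelVec {m n : Type*} [Fintype m] [DecidableEq m] [Fintype n]
    (M : Matrix m n ℂ) (N : Matrix n m ℂ) (v : n → ℂ) : n → ℂ :=
  fun l => (M * N).det * v l - (N *ᵥ ((M * N).adjugate *ᵥ (M *ᵥ v))) l

/-- If `M * N` is invertible, `kernelVec` is `det (M * N)` times the projection of `v` onto `ker M`
along the range of `N`. The adjugate in place of the inverse keeps it polynomial, and the identity
needs no invertibility. -/
theorem mulVec_kernelVec {m n : Type*} [Fintype m] [DecidableEq m] [Fintype n]
    (M : Matrix m n ℂ) (N : Matrix n m ℂ) (v : n → ℂ) : M *ᵥ kernelVec M N v = 0 := by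
  have : kernelVec M N v = (M * N).det • v - N *ᵥ ((M * N).adjugate *ᵥ (M *ᵥ v)) := rfl
  rw [this, mulVec_sub, mulVec_smul, mulVec_mulVec, mulVec_mulVec, mul_adjugate, smul_mulVec,
    one_mulVec, sub_self]

theorem kernelVec_of_mulVec_eq_zero {m n : Type*} [Fintype m] [DecidableEq m] [Fintype n]
    {M : Matrix m n ℂ} (N : Matrix n m ℂ) {v : n → ℂ} (h : M *ᵥ v = 0) (l : n) :
    kernelVec M N v l = (M * N).det * v l := by
  simp [kernelVec, h]

/-- A linear receiver that only uses the first `β` of `G` antennas. -/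
theorem exists_receiver {β G : ℕ} (hG : β ≤ G) (c : Fin β → ℂ) :
    ∃ u : Fin G → ℂ, ∀ z : Fin G → ℂ, star u ⬝ᵥ z = ∑ r, c r * z (Fin.castLE hG r) := by
  refine ⟨fun g => ∑ r, if Fin.castLE hG r = g then star (c r) else 0, fun z => ?_⟩
  simp only [dotProduct, Pi.star_apply, star_sum, Finset.sum_mul]
  rw [Finset.sum_comm]
  refine Finset.sum_congr rfl fun r _ => ?_
  rw [Finset.sum_eq_single (Fin.castLE hG r)]
  · simp
  · intro g _ hg
    simp [hg.symm]
  · simp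

theorem decodesLinearly_of_dotProduct {G L : ℕ} {ι : Type} [DecidableEq ι]
    {H : Matrix (Fin G) (Fin L) ℂ} {C : Finset ι} {w : ι → Fin L → ℂ} {u : Fin G → ℂ} {x₀ : ι}
    (hx₀ : x₀ ∈ C) (h : ∀ y ∈ C, star u ⬝ᵥ (H *ᵥ w y) = if y = x₀ then 1 else 0) :
    DecodesLinearly H C w u x₀ := by
  intro sym z
  rw [dotProduct_add, Matrix.mulVec_sum, dotProduct_sum]
  congr 1
  rw [Finset.sum_eq_single x₀]
  · rw [mulVec_smul, dotProduct_smul, h x₀ hx₀]; simp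
  · intro y hy hne
    rw [mulVec_smul, dotProduct_smul, h y hy]; simp [hne]
  · exact fun hn => absurd hx₀ hn

/-! ### Generic beamformers for one transmission. -/

namespace Beamforming

variable {ι : Type} {K G L β : ℕ}

/-- The users of `A` that do not want the codeword with user set `T`, together with the receive
antennas at which the codeword has to be nulled. -/
abbrev NulledAntennas (A T : Finset (Fin K)) (β : ℕ) : Type := {j // j ∈ A \ T} × Fin β

/-- The space of the channels and the two families of parameters of the beamformers. -/
abbrev Params (ι : Type) (K G L β : ℕ) : Type :=
  (Fin K → Fin G → Fin L → ℂ) × (ι → Fin L → Fin K → Fin β → ℂ) × (ι → Fin L → ℂ)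

/-- The channel to the nulled antennas. -/
def interferenceMatrix (hG : β ≤ G) (A T : Finset (Fin K)) (H : Fin K → Fin G → Fin L → ℂ) :
    Matrix (NulledAntennas A T β) (Fin L) ℂ :=
  Matrix.of fun q l => H q.1.1 (Fin.castLE hG q.2) l

/-- The matrix parameter of a beamformer. -/
def parameterMatrix (A T : Finset (Fin K)) (V : Fin L → Fin K → Fin β → ℂ) :
    Matrix (Fin L) (NulledAntennas A T β) ℂ :=
  Matrix.of fun l q => V l q.1.1 q.2

/-- The zero-forcing beamformer of the codeword `x`. -/
noncomputable def beamformer (hG : β ≤ G) (A : Finset (Fin K)) (T : ι → Finset (Fin K))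
    (z : Params ι K G L β) (x : ι) : Fin L → ℂ :=
  kernelVec (interferenceMatrix hG A (T x) z.1) (parameterMatrix A (T x) (z.2.1 x)) (z.2.2 x)

/-- The effective channel of user `k` for the codewords `e c`. -/
noncomputable def effectiveChannel (hG : β ≤ G) (A : Finset (Fin K)) (T : ι → Finset (Fin K))
    (k : Fin K) (e : Fin β → ι) (z : Params ι K G L β) : Matrix (Fin β) (Fin β) ℂ :=
  Matrix.of fun r c => ∑ l, z.1 k (Fin.castLE hG r) l * beamformer hG A T z (e c) l

theorem beamformer_mem (hG : β ≤ G) (A : Finset (Fin K)) (T : ι → Finset (Fin K)) (x : ι)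
    (l : Fin L) :
    (fun z => beamformer hG A T z x l) ∈ linewisePolynomial (Params ι K G L β) := by
  have hM : ∀ i j, (fun z : Params ι K G L β => interferenceMatrix hG A (T x) z.1 i j) ∈
      linewisePolynomial (Params ι K G L β) := fun i j =>
    linewisePolynomial.linear_mem (by simp only [interferenceMatrix, Matrix.of_apply]; fun_prop)
      fun a b s => by simp [interferenceMatrix]
  have hN : ∀ i j, (fun z : Params ι K G L β => parameterMatrix A (T x) (z.2.1 x) i j) ∈
      linewisePolynomial (Params ι K G L β) := fun i j =>
    linewisePolynomial.linear_mem (by simp only [parameterMatrix, Matrix.of_apply]; fun_prop)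
      fun a b s => by simp [parameterMatrix]
  have hv : ∀ j, (fun z : Params ι K G L β => z.2.2 x j) ∈
      linewisePolynomial (Params ι K G L β) := fun j =>
    linewisePolynomial.linear_mem (by fun_prop) fun a b s => by simp
  have hMN := linewisePolynomial.matrix_mul_mem hM hN
  exact linewisePolynomial.sub_mem
    (linewisePolynomial.mul_mem (linewisePolynomial.det_mem hMN) (hv l))
    (linewisePolynomial.mulVec_mem hN (linewisePolynomial.mulVec_mem
      (linewisePolynomial.adjugate_mem hMN) (linewisePolynomial.mulVec_mem hM hv)) l)

theorem det_effectiveChannel_mem (hG : β ≤ G) (A : Finset (Fin K)) (T : ι → Finset (Fin K))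
    (k : Fin K) (e : Fin β → ι) :
    (fun z => (effectiveChannel (L := L) hG A T k e z).det) ∈
      linewisePolynomial (Params ι K G L β) := by
  refine linewisePolynomial.det_mem fun r c => ?_
  simp only [effectiveChannel, Matrix.of_apply]
  exact linewisePolynomial.sum_mem _ fun l _ => linewisePolynomial.mul_mem
    (linewisePolynomial.linear_mem (by fun_prop) fun a b s => by simp) (beamformer_mem hG A T _ l)

/-- Nulled antennas have distinct representatives among the coordinates that are not occupied by
the wanted codewords of a user which they must not disturb. -/
theorem exists_coordinates {A : Finset (Fin K)} {T : Fin β → Finset (Fin K)} {a : ℕ}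
    (hβL : β ≤ L) (hcard : ∀ c, (A \ T c).card = a) (hTA : ∀ c, T c ⊆ A)
    (c₀ : Fin β)
    (hL : a * β + (Finset.univ.filter (fun c => T c = T c₀)).card ≤ L) :
    ∃ s : NulledAntennas A (T c₀) β → Fin L, Function.Injective s ∧
      ∀ q c, Fin.castLE hβL c = s q → q.1.1 ∈ T c := by
  classical
  let V : NulledAntennas A (T c₀) β → Finset (Fin L) := fun q =>
    Finset.univ.filter fun l => ∀ c, Fin.castLE hβL c = l → q.1.1 ∈ T c
  have hall : ∀ X : Finset (NulledAntennas A (T c₀) β), X.card ≤ (X.biUnion V).card := by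
    intro X
    rcases X.eq_empty_or_nonempty with rfl | ⟨q₀, hq₀⟩
    · simp
    let J : Finset (Fin K) := X.image fun q => q.1.1
    have hJ : J ⊆ A \ T c₀ := by
      intro j hj
      obtain ⟨q, -, rfl⟩ := Finset.mem_image.1 hj
      exact q.1.2
    have hX : X.card ≤ J.card * β := by
      calc X.card ≤ (J ×ˢ (Finset.univ : Finset (Fin β))).card := by
            refine Finset.card_le_card_of_injOn (fun q => (q.1.1, q.2)) ?_ ?_
            · intro q hq
              exact Finset.mem_coe.2 (Finset.mem_product.2
                ⟨Finset.mem_image_of_mem (fun q : NulledAntennas A (T c₀) β => q.1.1) hq,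
                  Finset.mem_univ _⟩)
            · rintro ⟨q, r⟩ _ ⟨q', r'⟩ _ h
              simp only [Prod.mk.injEq] at h
              exact Prod.ext (Subtype.ext h.1) h.2
        _ = J.card * β := by simp
    -- A coordinate is unavailable to all of `X` only if its codeword is wanted by no user of `J`,
    -- so Hall's condition reduces to `|J| β + |D| ≤ L`.
    let D : Finset (Fin β) := Finset.univ.filter fun c => Disjoint (T c) J
    have hcompl : (X.biUnion V)ᶜ ⊆ D.image (Fin.castLE hβL) := by
      intro l hl
      simp only [Finset.mem_compl, Finset.mem_biUnion, not_exists, not_and] at hl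
      have h1 : ∀ q ∈ X, ∃ c, Fin.castLE hβL c = l ∧ q.1.1 ∉ T c := by
        intro q hq
        have := hl q hq
        simp only [V, Finset.mem_filter, Finset.mem_univ, true_and] at this
        push Not at this
        exact this
      obtain ⟨c, hc, -⟩ := h1 q₀ hq₀
      refine Finset.mem_image.2 ⟨c, ?_, hc⟩
      simp only [D, Finset.mem_filter, Finset.mem_univ, true_and]
      rw [Finset.disjoint_right]
      intro j hj
      obtain ⟨q, hq, rfl⟩ := Finset.mem_image.1 hj
      obtain ⟨c', hc', hn⟩ := h1 q hq
      have : c' = c := Fin.castLE_injective hβL (hc'.trans hc.symm)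
      exact this ▸ hn
    have hD : J.card * β + D.card ≤ L := by
      -- If `J` is all of `A \ T c₀`, then `D` contains only codewords with index set `T c₀`, and
      -- the multiplicity bound applies. Otherwise `|J| ≤ a - 1`, and the spare `β` pays for `|D| ≤
      -- β`.
      by_cases hJa : J.card = a
      · have hJe : J = A \ T c₀ := Finset.eq_of_subset_of_card_le hJ (by rw [hcard, hJa])
        have hsub : D ⊆ Finset.univ.filter (fun c => T c = T c₀) := by
          intro c hc
          simp only [D, Finset.mem_filter, Finset.mem_univ, true_and] at hc ⊢
          have h1 : T c ⊆ T c₀ := by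
            intro j hj
            by_contra hn
            exact Finset.disjoint_left.1 hc hj (hJe ▸ Finset.mem_sdiff.2 ⟨hTA c hj, hn⟩)
          refine Finset.eq_of_subset_of_card_le h1 ?_
          have h2 := hcard c
          have h3 := hcard c₀
          rw [Finset.card_sdiff_of_subset (hTA _)] at h2 h3
          have h4 := Finset.card_le_card (hTA c)
          have h5 := Finset.card_le_card (hTA c₀)
          have h6 := Finset.card_le_card h1
          omega
        have := Finset.card_le_card hsub
        rw [hJa]
        omega
      · have h1 : J.card + 1 ≤ a := by
          have := Finset.card_le_card hJ
          rw [hcard] at this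
          omega
        have h2 : D.card ≤ β := (Finset.card_le_univ D).trans (by simp)
        have h3 := Nat.mul_le_mul_right β h1
        rw [Nat.succ_mul] at h3
        omega
    have h4 := (Finset.card_le_card hcompl).trans Finset.card_image_le
    rw [Finset.card_compl, Fintype.card_fin] at h4
    omega
  obtain ⟨s, hs, hsV⟩ := (Finset.all_card_le_biUnion_card_iff_exists_injective V).1 hall
  exact ⟨s, hs, fun q => by simpa [V] using hsV q⟩

/-- The `c`-th codeword of user `k` is sent along the `c`-th unit vector, over a channel in which
this coordinate does not reach users that do not want it. Zero forcing then only rescales the unit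
vector by `det (M * N)`, and an identity channel to `k` makes the effective channel diagonal. It
remains to keep these determinants nonzero. -/
theorem exists_det_effectiveChannel_ne_zero (hG : β ≤ G) (hβL : β ≤ L) {A : Finset (Fin K)}
    {T : ι → Finset (Fin K)} {a : ℕ} {k : Fin K} {e : Fin β → ι} (he : Function.Injective e)
    (hk : ∀ c, k ∈ T (e c)) (hcard : ∀ c, (A \ T (e c)).card = a) (hTA : ∀ c, T (e c) ⊆ A)
    (hL : ∀ c₀, a * β + (Finset.univ.filter (fun c => T (e c) = T (e c₀))).card ≤ L) :
    ∃ z : Params ι K G L β, (effectiveChannel hG A T k e z).det ≠ 0 := by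
  classical
  let mask : Fin K → Fin L → ℂ := fun j l =>
    if ∀ c, Fin.castLE hβL c = l → j ∈ T (e c) then 1 else 0
  let masked : (Fin K → Fin G → Fin L → ℂ) → Fin K → Fin G → Fin L → ℂ :=
    fun H j g l => mask j l * H j g l
  let F : Type := (Fin K → Fin G → Fin L → ℂ) × (Fin β → Fin L → Fin K → Fin β → ℂ)
  let h : Fin β → F → ℂ := fun c z =>
    (interferenceMatrix hG A (T (e c)) (masked z.1) *
      parameterMatrix A (T (e c)) (z.2 c)).det
  have hmem : ∀ c, h c ∈ linewisePolynomial F := fun c => by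
    refine linewisePolynomial.det_mem (linewisePolynomial.matrix_mul_mem (fun i j => ?_)
      (fun i j => ?_))
    · refine linewisePolynomial.linear_mem ?_ fun y z s => ?_
      · simp only [interferenceMatrix, Matrix.of_apply, masked, F]
        fun_prop
      · change mask i.1.1 j * (y.1 i.1.1 (Fin.castLE hG i.2) j +
          s * z.1 i.1.1 (Fin.castLE hG i.2) j) = _
        simp only [interferenceMatrix, Matrix.of_apply, masked]
        ring
    · refine linewisePolynomial.linear_mem ?_ fun y z s => ?_
      · simp only [parameterMatrix, Matrix.of_apply, F]
        fun_prop
      · rfl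
  -- The representatives `s` avoid the masked entries, so the 0-1 matrix of `s` is an admissible
  -- interference matrix; its transpose as parameter gives product `1`. The witness depends on `c₀`;
  -- genericity then yields a common one.
  have hne : ∀ c₀, ∃ z, h c₀ z ≠ 0 := fun c₀ => by
    obtain ⟨s, hs, hsT⟩ := exists_coordinates (T := fun c => T (e c)) hβL hcard hTA c₀ (hL c₀)
    let H : Fin K → Fin G → Fin L → ℂ := fun j g l =>
      if ∃ q, q.1.1 = j ∧ Fin.castLE hG q.2 = g ∧ s q = l then 1 else 0
    let V : Fin L → Fin K → Fin β → ℂ := fun l j r =>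
      if ∃ q, q.1.1 = j ∧ q.2 = r ∧ s q = l then 1 else 0
    refine ⟨(H, fun _ => V), ?_⟩
    have hM : interferenceMatrix hG A (T (e c₀)) (masked H) =
        Matrix.of fun q l => if s q = l then (1 : ℂ) else 0 := by
      ext q l
      simp only [interferenceMatrix, Matrix.of_apply, masked]
      by_cases hq : s q = l
      · have h1 : mask q.1.1 l = 1 := if_pos fun c hc => hsT q c (hc.trans hq.symm)
        have h2 : H q.1.1 (Fin.castLE hG q.2) l = 1 := if_pos ⟨q, rfl, rfl, hq⟩
        rw [h1, h2, if_pos hq, one_mul]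
      · have h2 : H q.1.1 (Fin.castLE hG q.2) l = 0 := by
          refine if_neg ?_
          rintro ⟨q', h1, h2, h3⟩
          have : q' = q := Prod.ext (Subtype.ext h1) (Fin.castLE_injective hG h2)
          exact hq (this ▸ h3)
        rw [h2, if_neg hq, mul_zero]
    have hN : parameterMatrix A (T (e c₀)) V =
        Matrix.of fun l q => if s q = l then (1 : ℂ) else 0 := by
      ext l q
      simp only [parameterMatrix, Matrix.of_apply, V]
      congr 1
      refine propext ⟨?_, fun hq => ⟨q, rfl, rfl, hq⟩⟩
      rintro ⟨q', h1, h2, h3⟩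
      have : q' = q := Prod.ext (Subtype.ext h1) h2
      exact this ▸ h3
    have hMN : interferenceMatrix hG A (T (e c₀)) (masked H) * parameterMatrix A (T (e c₀)) V =
        1 := by
      rw [hM, hN]
      ext q q'
      simp [Matrix.mul_apply, Matrix.one_apply, hs.eq_iff, eq_comm]
    simp only [h]
    rw [hMN, det_one]
    exact one_ne_zero
  obtain ⟨⟨H, V⟩, hHV⟩ := linewisePolynomial.exists_forall_ne_zero Finset.univ
    (fun c _ => hmem c) (fun c _ => hne c)
  let H₀ : Fin K → Fin G → Fin L → ℂ := fun j g l =>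
    if j = k then (if g.1 = l.1 then 1 else 0) else masked H j g l
  let v : Fin β → Fin L → ℂ := fun c => Pi.single (Fin.castLE hβL c) 1
  have hH₀ : ∀ c, interferenceMatrix hG A (T (e c)) H₀ =
      interferenceMatrix hG A (T (e c)) (masked H) := fun c => by
    ext q l
    have : q.1.1 ≠ k := fun hq => (Finset.mem_sdiff.1 q.1.2).2 (hq ▸ hk c)
    simp [interferenceMatrix, H₀, this]
  have hker : ∀ c, interferenceMatrix hG A (T (e c)) (masked H) *ᵥ v c = 0 := fun c => by
    ext q
    have h1 : mask q.1.1 (Fin.castLE hβL c) = 0 :=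
      if_neg fun hq => (Finset.mem_sdiff.1 q.1.2).2 (hq c rfl)
    simp [v, interferenceMatrix, masked, h1]
  refine ⟨(H₀, Function.extend e V 0, Function.extend e v 0), ?_⟩
  have hdiag : effectiveChannel hG A T k e (H₀, Function.extend e V 0, Function.extend e v 0) =
      Matrix.diagonal fun c => h c (H, V) := by
    ext r c
    simp only [effectiveChannel, Matrix.of_apply, beamformer, he.extend_apply, hH₀]
    simp only [kernelVec_of_mulVec_eq_zero _ (hker c)]
    rw [Finset.sum_eq_single (Fin.castLE hβL r)]
    · by_cases hrc : r = c
      · subst hrc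
        simp [H₀, h, v]
      · rw [Matrix.diagonal_apply_ne _ hrc]
        have : Fin.castLE hβL r ≠ Fin.castLE hβL c :=
          fun h' => hrc (Fin.castLE_injective hβL h')
        simp [v, this]
    · intro l _ hl
      have : r.1 ≠ l.1 := fun h' => hl (Fin.ext h'.symm)
      simp [H₀, this]
    · simp
  rw [hdiag, det_diagonal]
  exact Finset.prod_ne_zero_iff.2 fun c _ => hHV c (Finset.mem_univ c)

/-- Each user's determinant is a nonzero polynomial in channel and parameters, so some point is good
for all users at once. Its parameters `V`, `v` are then frozen, and the determinants remain nonzero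
polynomials in the channel alone. -/
theorem ae_exists_beamformers [DecidableEq ι] {A : Finset (Fin K)} {C : Finset ι}
    {T : ι → Finset (Fin K)} {a : ℕ} (hG : β ≤ G)
    (hβ : ∀ k ∈ A, (C.filter (fun x => k ∈ T x)).card = β) (hTA : ∀ x ∈ C, T x ⊆ A)
    (hcard : ∀ x ∈ C, (A \ T x).card = a)
    (hL : ∀ x ∈ C, a * β + (C.filter (fun y => T y = T x)).card ≤ L) :
    ∀ᵐ H ∂(channelLaw K G L), ∃ w : ι → Fin L → ℂ, ∀ k ∈ A, ∃ u : ι → Fin G → ℂ,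
      ∀ x ∈ C, k ∈ T x → DecodesLinearly (Matrix.of (H k)) C w (u x) x := by
  classical
  -- For `a > 0` this is `aβ ≤ L`; for `a = 0` all codewords have index set `A`, so the multiplicity
  -- is `β` itself.
  have hβL : ∀ k ∈ A, β ≤ L := by
    intro k hk
    rcases Nat.eq_zero_or_pos β with h0 | h0
    · omega
    rw [← hβ k hk] at h0
    obtain ⟨x, hx⟩ := Finset.card_pos.1 h0
    obtain ⟨hxC, -⟩ := Finset.mem_filter.1 hx
    have h1 := hL x hxC
    rcases Nat.eq_zero_or_pos a with ha | ha
    · have hfull : ∀ y ∈ C, T y = A := fun y hy =>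
        Finset.Subset.antisymm (hTA y hy)
          (Finset.sdiff_eq_empty_iff_subset.1 (Finset.card_eq_zero.1 ((hcard y hy).trans ha)))
      have h2 : β ≤ (C.filter (fun y => T y = T x)).card := by
        rw [← hβ k hk]
        refine Finset.card_le_card fun y hy => ?_
        obtain ⟨hyC, -⟩ := Finset.mem_filter.1 hy
        exact Finset.mem_filter.2 ⟨hyC, (hfull y hyC).trans (hfull x hxC).symm⟩
      omega
    · have := Nat.le_mul_of_pos_left β ha
      omega
  have hex : ∀ k : {k // k ∈ A}, ∃ e : Fin β → ι, Function.Injective e ∧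
      ∀ x, (x ∈ C ∧ k.1 ∈ T x) ↔ ∃ c, e c = x := by
    intro k
    let e := (C.filter (fun x => k.1 ∈ T x)).equivFinOfCardEq (hβ k.1 k.2)
    refine ⟨fun c => (e.symm c).1, fun c c' h => e.symm.injective (Subtype.ext h), fun x => ?_⟩
    constructor
    · rintro ⟨h1, h2⟩
      exact ⟨e ⟨x, Finset.mem_filter.2 ⟨h1, h2⟩⟩, by simp⟩
    · rintro ⟨c, rfl⟩
      exact Finset.mem_filter.1 (e.symm c).2
  choose e heinj he using hex
  have hgood : ∀ k : {k // k ∈ A}, ∃ z : Params ι K G L β,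
      (effectiveChannel hG A T k.1 (e k) z).det ≠ 0 := by
    intro k
    have hmem : ∀ c, e k c ∈ C ∧ k.1 ∈ T (e k c) := fun c => (he k _).2 ⟨c, rfl⟩
    refine exists_det_effectiveChannel_ne_zero hG (hβL k.1 k.2) (heinj k) (fun c => (hmem c).2)
      (fun c => hcard _ (hmem c).1) (fun c => hTA _ (hmem c).1) fun c₀ => ?_
    refine le_trans (Nat.add_le_add_left ?_ _) (hL _ (hmem c₀).1)
    refine Finset.card_le_card_of_injOn (e k) ?_ (heinj k).injOn
    intro c hc
    simp only [Finset.coe_filter, Finset.mem_univ, true_and] at hc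
    exact Finset.mem_coe.2 (Finset.mem_filter.2 ⟨(hmem c).1, hc⟩)
  obtain ⟨⟨H₀, V, v⟩, hz⟩ := linewisePolynomial.exists_forall_ne_zero Finset.univ
    (fun k _ => det_effectiveChannel_mem (L := L) hG A T k.1 (e k)) (fun k _ => hgood k)
  have hae : ∀ᵐ H ∂(channelLaw K G L), ∀ k : {k // k ∈ A},
      (effectiveChannel hG A T k.1 (e k) (H, V, v)).det ≠ 0 := by
    rw [ae_all_iff]
    intro k
    refine avoidsPolynomialZeros_channelLaw K G L _ (linewisePolynomial.comp_mem
      (det_effectiveChannel_mem (L := L) hG A T k.1 (e k))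
      (g := fun H => (H, V, v)) measurable_prodMk_right
      fun b c => ⟨(b, V, v), (c, 0, 0), fun s => by simp⟩) ⟨H₀, hz k (Finset.mem_univ k)⟩
  filter_upwards [hae] with H hH
  refine ⟨beamformer hG A T (H, V, v), fun k hk => ?_⟩
  let D := effectiveChannel hG A T k (e ⟨k, hk⟩) (H, V, v)
  have hD : IsUnit D.det := isUnit_iff_ne_zero.2 (hH ⟨k, hk⟩)
  have hu : ∀ x, ∃ u : Fin G → ℂ, x ∈ C → k ∈ T x → DecodesLinearly (Matrix.of (H k)) C
      (beamformer hG A T (H, V, v)) u x := by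
    intro x
    by_cases hx : x ∈ C ∧ k ∈ T x
    swap
    · exact ⟨0, fun h1 h2 => absurd ⟨h1, h2⟩ hx⟩
    obtain ⟨c, rfl⟩ := (he ⟨k, hk⟩ x).1 hx
    -- Row `c` of `D⁻¹` separates the wanted streams. Unwanted ones vanish at the first `β`
    -- antennas, the only ones read by `u`.
    obtain ⟨u, hu⟩ := exists_receiver hG (D⁻¹ c)
    refine ⟨u, fun hxC _ => decodesLinearly_of_dotProduct hxC fun y hy => ?_⟩
    rw [hu]
    by_cases hky : k ∈ T y
    · obtain ⟨c', rfl⟩ := (he ⟨k, hk⟩ y).1 ⟨hy, hky⟩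
      have h1 : (D⁻¹ * D) c c' = (1 : Matrix (Fin β) (Fin β) ℂ) c c' := by
        rw [Matrix.nonsing_inv_mul _ hD]
      rw [Matrix.mul_apply, Matrix.one_apply] at h1
      simp only [(heinj ⟨k, hk⟩).eq_iff, eq_comm (a := c')]
      rw [← h1]
      rfl
    · have hne : y ≠ e ⟨k, hk⟩ c := fun h => hky (h ▸ hx.2)
      rw [if_neg hne]
      refine Finset.sum_eq_zero fun r _ => ?_
      have h1 := congrFun (mulVec_kernelVec (interferenceMatrix hG A (T y) H)
        (parameterMatrix A (T y) (V y)) (v y)) (⟨k, Finset.mem_sdiff.2 ⟨hk, hky⟩⟩, r)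
      have h2 : (Matrix.of (H k) *ᵥ beamformer hG A T (H, V, v) y) (Fin.castLE hG r) = 0 := h1
      rw [h2, mul_zero]
  choose u hu using hu
  exact ⟨u, hu⟩

end Beamforming

/-! ### Assembly of the scheme. -/

theorem theorem3 (K L G t Ω δ η : ℕ) (htΩ : t + 1 ≤ Ω) (hΩK : Ω ≤ K)
    (hδ : 0 < δ) (hη : 0 < η) (hdvd : η ∣ δ * S0 t Ω)
    (hbound : (η : ℝ) ≤ min
      ((L : ℝ) * (S0 t Ω : ℝ) / (1 + ((Ω : ℝ) - (t : ℝ) - 1) * (S0 t Ω : ℝ) * (beta0 t Ω : ℝ)))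
      ((G : ℝ) / (beta0 t Ω : ℝ))) :
    Nonempty (DeliveryPlan K t Ω δ) ∧
    ∀ p : DeliveryPlan K t Ω δ,
      -- every transmission consists of XOR codewords of size t + 1 for users of the target set,
      -- and contains exactly η β₀ codewords for each target user
      (∀ (A : TargetSet K Ω) (r : Fin (δ * S0 t Ω / η)),
        (∀ x ∈ p.block η A r, x.2.1 ⊆ A.1 ∧ x.2.1.card = t + 1) ∧
        ∀ k ∈ A.1, ((p.block η A r).filter (fun x => k ∈ x.2.1)).card = η * beta0 t Ω) ∧
      -- almost surely, in every transmission, with suitable transmit beamformers w, each target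
      -- user decodes all of these streams with linear receive beamformers u
      (∀ᵐ H ∂(channelLaw K G L), ∀ (A : TargetSet K Ω) (r : Fin (δ * S0 t Ω / η)),
        ∃ w : Fin δ × CodewordIdx K t → Fin L → ℂ,
          ∀ k ∈ A.1, ∃ u : Fin δ × CodewordIdx K t → Fin G → ℂ,
            ∀ x ∈ p.block η A r, k ∈ x.2.1 →
              DecodesLinearly (Matrix.of (H k)) (p.block η A r) w (u x) x) ∧
      -- different streams carry different subpackets for a user, none of them in its cache
      (∀ k : Fin K, Function.Injective (p.subpacketOf (η := η) (k := k)) ∧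
        ∀ y : p.Stream η k, k ∉ (p.subpacketOf y).1.1) ∧
      -- for all demands, each user obtains from each of its codewords and its cache the subpacket
      -- of its requested file, and from all its codewords and its cache the whole file
      (∀ (N b : ℕ) (dem : Fin K → Fin N) (k : Fin K),
        (∀ y : p.Stream η k,
          ∃ dec : CacheData K N t (numSub K t Ω δ) b k → Bits b → Bits b,
            ∀ W : Fin N → FileData K t (numSub K t Ω δ) b,
              dec (cacheOf W k) (p.codewordOf W dem y) =
                W (dem k) (p.subpacketOf y).1 (p.subpacketOf y).2) ∧
        ∃ dec : CacheData K N t (numSub K t Ω δ) b k → (p.Stream η k → Bits b) →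
            FileData K t (numSub K t Ω δ) b,
          ∀ W : Fin N → FileData K t (numSub K t Ω δ) b,
            dec (cacheOf W k) (fun y => p.codewordOf W dem y) = W (dem k)) := by
  obtain ⟨hb1, hb2⟩ := le_min_iff.1 hbound
  have hβ0 : (0 : ℝ) < beta0 t Ω := by exact_mod_cast beta0_pos t Ω
  have hG : η * beta0 t Ω ≤ G := by
    rw [le_div_iff₀ hβ0] at hb2
    exact_mod_cast hb2
  obtain ⟨a, rfl⟩ : ∃ a, Ω = t + 1 + a := ⟨Ω - (t + 1), by omega⟩
  have hkey : η + a * (η * beta0 t (t + 1 + a)) * S0 t (t + 1 + a) ≤ L * S0 t (t + 1 + a) := by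
    have h1 : ((t + 1 + a : ℕ) : ℝ) - t - 1 = a := by push_cast; ring
    rw [h1, le_div_iff₀ (by positivity)] at hb1
    have h2 : (η : ℝ) + a * (η * beta0 t (t + 1 + a)) * S0 t (t + 1 + a) ≤
        L * S0 t (t + 1 + a) := by linarith
    exact_mod_cast h2
  have haL : a * (η * beta0 t (t + 1 + a)) ≤ L := by
    by_contra! hlt
    have := Nat.mul_le_mul_right (S0 t (t + 1 + a)) hlt.le
    omega
  -- The multiplicity bound is used with `X = L - aβ`; `haL` ensures that this subtraction is not
  -- truncated.
  have hX : η ≤ (L - a * (η * beta0 t (t + 1 + a))) * S0 t (t + 1 + a) := by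
    rw [Nat.sub_mul]
    omega
  refine ⟨nonempty_deliveryPlan htΩ hΩK hδ, fun p => ⟨fun A r => ⟨fun x hx =>
    ⟨p.subset_of_mem_block hx, x.2.2⟩, fun k hk => p.card_filter_block hη A r hk⟩, ?_,
    fun k => ⟨p.subpacketOf_injective k, p.notMem_subpacketOf⟩, fun N b dem k =>
    ⟨p.exists_decoder dem, p.exists_file_decoder hdvd dem k⟩⟩⟩
  rw [ae_all_iff]
  intro A
  rw [ae_all_iff]
  intro r
  refine Beamforming.ae_exists_beamformers (T := fun x : Fin δ × CodewordIdx K t => x.2.1)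
    (a := a) hG (fun k hk => p.card_filter_block hη A r hk) (fun x hx => p.subset_of_mem_block hx)
    (fun x hx => ?_) (fun x hx => ?_)
  · rw [Finset.card_sdiff_of_subset (p.subset_of_mem_block hx), A.2, x.2.2]
    omega
  · have h1 := p.card_filter_eq_block hη hX hx
    simp only [Subtype.ext_iff] at h1
    omega
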